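/- Let $(\mathcal C,\mathcal E)$ be an \emph{exact IT-context}, i.e. a skeletally small Quillen exact category in which every object is a finite direct sum of objects with local endomorphism rings and which has enough $\mathcal E$-projectives; assume moreover that $\mathcal C$ is weakly idempotent complete (every split monomorphism has a cokernel). Write $\mathcal P(\mathcal E)$ for the class of $\mathcal E$-projectives, $\mathrm{Ext}^n_{\mathcal E}(X,Y)=H^n(\mathrm{Hom}(P_\bullet(X),Y))$ with $P_\bullet(X)$ an $\mathcal E$-projective resolution of $X$, and $$\mathrm{pd}_{\mathcal E}(X)=\min\{n\in\mathbb N:\mathrm{Ext}^j_{\mathcal E}(X,Z)=0\ \forall j>n,\ \forall Z\in\mathcal C\},\qquad \mathrm{id}_{\mathcal E}(X)=\min\{n\in\mathbb N:\mathrm{Ext}^j_{\mathcal E}(Z,X)=0\ \forall j>n,\ \forall Z\in\mathcal C\}$$ ($\infty$ if there is no such $n$). For a class $\mathcal Y$ of objects put $\mathrm{id}_{\mathcal E}(\mathcal Y)=\sup_{Y\in\mathcal Y}\mathrm{id}_{\mathcal E}(Y)$ and $\mathrm{fpd}_{\mathcal E}(\mathcal Y)=\sup\{\mathrm{pd}_{\mathcal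 E}(Y):Y\in\mathcal Y,\ \mathrm{pd}_{\mathcal E}(Y)<\infty\}$. An $\mathcal E$-syzygy $\Omega_{\mathcal E}(X)$ of $X$ is the kernel of an admissible epimorphism $P\to X$ with $P\in\mathcal P(\mathcal E)$; $\Omega^n_{\mathcal E}(\mathcal C)$ is the class of all $n$-th $\mathcal E$-syzygies of objects of $\mathcal C$. Let $K_{\mathcal E}(\mathcal C)$ be the free abelian group on the isomorphism classes $[M]$ of objects of $\mathcal C$ modulo the relations $[S\oplus T]=[S]+[T]$ and $[P]=0$ for $P\in\mathcal P(\mathcal E)$; then $[M]\mapsto[\Omega_{\mathcal E}(M)]$ is a well-defined endomorphism $\Omega_{\mathcal E}$ of $K_{\mathcal E}(\mathcal C)$. For $M\in\mathcal C$ let $\langle M\rangle\subseteq K_{\mathcal E}(\mathcal C)$ be the subgroup generated by the indecomposable direct summands of $M$ in the stable category $\mathcal C/\mathcal P(\mathcal E)$, and let $$\Phi_{\mathcal E}(M)=\min\{k\in\mathbb N:\Omega_{\mathcal E}:\Omega_{\mathcal E}^m\langle M\rangle\to\Omega_{\mathcal E}^{m+1}\langle M\rangle\text{ is an isomorphism for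 all }m\ge k\},$$ $$\Psi_{\mathcal E}(M)=\Phi_{\mathcal E}(M)+\mathrm{fpd}_{\mathcal E}\bigl(\mathrm{add}(\Omega_{\mathcal E}^{\Phi_{\mathcal E}(M)}(M))\bigr).$$ For a class $\mathcal Y$ let $\Phi_{\mathcal E}\mathrm{dim}(\mathcal Y)$ and $\Psi_{\mathcal E}\mathrm{dim}(\mathcal Y)$ be the suprema of $\Phi_{\mathcal E}$ and $\Psi_{\mathcal E}$ on $\mathcal Y$. Then: (a) If $n:=\mathrm{id}_{\mathcal E}(\mathcal P(\mathcal E))$ is finite, then $\Phi_{\mathcal E}\mathrm{dim}(\Omega^n_{\mathcal E}(\mathcal C))=0=\Psi_{\mathcal E}\mathrm{dim}(\Omega^n_{\mathcal E}(\mathcal C))$. (b) $\mathrm{fpd}_{\mathcal E}(\mathcal C)\le\Phi_{\mathcal E}\mathrm{dim}(\mathcal C)\le\Psi_{\mathcal E}\mathrm{dim}(\mathcal C)\le\mathrm{id}_{\mathcal E}(\mathcal P(\mathcal E))$. (c) Let $\Lambda$ be an artin algebra (a module-finite algebra over a commutative artinian ring), let $\mathrm{findim}\,\Lambda$ be the supremum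 of the projective dimensions of the finitely generated left $\Lambda$-modules of finite projective dimension, let $\mathrm{id}({}_\Lambda\Lambda)$ be the injective dimension of the left module $\Lambda$ in the category $\mathrm{mod}\,\Lambda$ of finitely generated left $\Lambda$-modules, and let $\Phi\mathrm{dim}\,\Lambda$, $\Psi\mathrm{dim}\,\Lambda$ be $\Phi_{\mathcal E}\mathrm{dim}(\mathcal C)$, $\Psi_{\mathcal E}\mathrm{dim}(\mathcal C)$ for $\mathcal C=\mathrm{mod}\,\Lambda$ and $\mathcal E$ the class of all short exact sequences. Then $$\mathrm{findim}\,\Lambda\le\Phi\mathrm{dim}\,\Lambda\le\Psi\mathrm{dim}\,\Lambda\le\mathrm{id}({}_\Lambda\Lambda).$$ -/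

import Mathlib

open CategoryTheory CategoryTheory.Limits

universe w v u

set_option linter.unusedSectionVars false

noncomputable section

/-! ## Exact categories -/

/-- A Quillen exact structure on an additive category: a class of kernel-cokernel pairs
`A ⟶ B ⟶ C` (the short exact sequences of the structure), closed under isomorphism and
satisfying the usual six axioms on admissible monics and admissible epics. -/
structure ExactStructure (C : Type u) [Category.{v} C] [Preadditive C] where
  /-- the short sequences that are declared exact -/
  IsExact : ShortComplex C → Prop
  kernel : ∀ S, IsExact S → Nonempty (IsLimit (KernelFork.ofι S.f S.zero))
  cokernel : ∀ S, IsExact S → Nonempty (IsColimit (CokernelCofork.ofπ S.g S.zero))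
  of_iso : ∀ S T : ShortComplex C, Nonempty (S ≅ T) → IsExact S → IsExact T
  id_monic : ∀ A : C, ∃ (Z : C) (p : A ⟶ Z) (h : 𝟙 A ≫ p = 0), IsExact (ShortComplex.mk (𝟙 A) p h)
  id_epic : ∀ A : C, ∃ (Z : C) (i : Z ⟶ A) (h : i ≫ 𝟙 A = 0), IsExact (ShortComplex.mk i (𝟙 A) h)
  comp_monic : ∀ {A B D : C} (i : A ⟶ B) (j : B ⟶ D),
    (∃ (Z : C) (p : B ⟶ Z) (h : i ≫ p = 0), IsExact (ShortComplex.mk i p h)) →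
    (∃ (Z : C) (p : D ⟶ Z) (h : j ≫ p = 0), IsExact (ShortComplex.mk j p h)) →
    ∃ (Z : C) (p : D ⟶ Z) (h : (i ≫ j) ≫ p = 0), IsExact (ShortComplex.mk (i ≫ j) p h)
  comp_epic : ∀ {A B D : C} (p : A ⟶ B) (q : B ⟶ D),
    (∃ (Z : C) (i : Z ⟶ A) (h : i ≫ p = 0), IsExact (ShortComplex.mk i p h)) →
    (∃ (Z : C) (i : Z ⟶ B) (h : i ≫ q = 0), IsExact (ShortComplex.mk i q h)) →
    ∃ (Z : C) (i : Z ⟶ A) (h : i ≫ p ≫ q = 0), IsExact (ShortComplex.mk i (p ≫ q) h)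
  pushout_monic : ∀ {A B A' : C} (i : A ⟶ B) (f : A ⟶ A'),
    (∃ (Z : C) (p : B ⟶ Z) (h : i ≫ p = 0), IsExact (ShortComplex.mk i p h)) →
    ∃ (B' : C) (f' : B ⟶ B') (i' : A' ⟶ B'), IsPushout i f f' i' ∧
      ∃ (Z : C) (p : B' ⟶ Z) (h : i' ≫ p = 0), IsExact (ShortComplex.mk i' p h)
  pullback_epic : ∀ {B D D' : C} (p : B ⟶ D) (f : D' ⟶ D),
    (∃ (Z : C) (i : Z ⟶ B) (h : i ≫ p = 0), IsExact (ShortComplex.mk i p h)) →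
    ∃ (B' : C) (f' : B' ⟶ B) (p' : B' ⟶ D'), IsPullback f' p' p f ∧
      ∃ (Z : C) (i : Z ⟶ B') (h : i ≫ p' = 0), IsExact (ShortComplex.mk i p' h)

/-- Every split monomorphism has a cokernel. -/
def WeaklyIdempotentComplete (C : Type u) [Category.{v} C] [Preadditive C] : Prop :=
  ∀ ⦃X Y : C⦄ (s : X ⟶ Y), IsSplitMono s → HasCokernel s

/-- Every object is a finite direct sum of objects with local endomorphism ring. -/
def IsKrullSchmidt (C : Type u) [Category.{v} C] [Preadditive C] [HasFiniteBiproducts C] : Prop :=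
  ∀ X : C, ∃ (n : ℕ) (f : Fin n → C), (∀ i, IsLocalRing (End (f i))) ∧ Nonempty (X ≅ ⨁ f)

namespace ExactStructure

section Basic

variable {C : Type u} [Category.{v} C] [Preadditive C] (E : ExactStructure C)

/-- `P` is projective relative to `E`: `Hom(P, -)` turns each short `E`-exact sequence into a
short exact sequence of abelian groups (only surjectivity on the right is not automatic). -/
def IsProjective (P : C) : Prop :=
  ∀ S : ShortComplex C, E.IsExact S → ∀ f : P ⟶ S.X₃, ∃ g : P ⟶ S.X₂, g ≫ S.g = f

theorem isProjective_of_isZero {P : C} (h : IsZero P) : E.IsProjective P :=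
  fun _ _ _ => ⟨0, h.eq_of_src _ _⟩

/-- A short `E`-exact sequence `K ⟶ P ⟶ X` with `P` an `E`-projective object;
its left term `K` is an `E`-syzygy of `X`. -/
structure Presentation (X : C) where
  K : C
  P : C
  i : K ⟶ P
  p : P ⟶ X
  zero : i ≫ p = 0
  exact : E.IsExact (ShortComplex.mk i p zero)
  projective : E.IsProjective P

/-- There are enough `E`-projectives. -/
class EnoughProjectives : Prop where
  presentation : ∀ X : C, Nonempty (E.Presentation X)

/-- `K` is an `n`-th `E`-syzygy of `M`. -/
def IsSyzygy : ℕ → C → C → Prop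
  | 0, K, M => Nonempty (K ≅ M)
  | n + 1, K, M => ∃ (L : C) (q : E.Presentation L), IsSyzygy n L M ∧ Nonempty (K ≅ q.K)

/-- The class `Ω_E^n(C)` of all `n`-th `E`-syzygies of objects of `C`. -/
def syzygyClass (n : ℕ) (K : C) : Prop := ∃ M : C, E.IsSyzygy n K M

/-- An `E`-projective resolution of `X`, cut into short `E`-exact sequences
`Z (n+1) ⟶ P n ⟶ Z n` with `Z 0 = X`. -/
structure ProjRes (X : C) where
  Z : ℕ → C
  P : ℕ → C
  i : ∀ n, Z (n + 1) ⟶ P n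
  p : ∀ n, P n ⟶ Z n
  zero : ∀ n, i n ≫ p n = 0
  exact : ∀ n, E.IsExact (ShortComplex.mk (i n) (p n) (zero n))
  projective : ∀ n, E.IsProjective (P n)
  aug : Z 0 = X

namespace ProjRes

variable {E} {X : C} (R : E.ProjRes X) (B : C)

/-- The differential `P (n+1) ⟶ P n`. -/
def d (n : ℕ) : R.P (n + 1) ⟶ R.P n := R.p (n + 1) ≫ R.i n

/-- Precomposition with the differential, `Hom(P n, B) → Hom(P (n+1), B)`. -/
def dHom (n : ℕ) : (R.P n ⟶ B) →+ (R.P (n + 1) ⟶ B) where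
  toFun f := R.d n ≫ f
  map_zero' := by simp
  map_add' := by simp

/-- The `n`-coboundaries of the complex `Hom(P, B)`. -/
def coboundaries : (n : ℕ) → AddSubgroup (R.P n ⟶ B)
  | 0 => ⊥
  | n + 1 => (R.dHom B n).range

/-- The `n`-th cohomology group of the complex `Hom(P, B)`. -/
abbrev cohomology (n : ℕ) : Type v :=
  (R.dHom B n).ker ⧸ (R.coboundaries B n).addSubgroupOf (R.dHom B n).ker

end ProjRes

variable [E.EnoughProjectives]

/-- A fixed choice, for each object, of a presentation by an `E`-projective. -/
def presentation (X : C) : E.Presentation X := (EnoughProjectives.presentation X).some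

/-- The chosen `E`-syzygy `Ω_E(X)`. -/
def syzygy (X : C) : C := (E.presentation X).K

/-- The `E`-projective resolution spliced from the chosen presentations. -/
def resolution (X : C) : E.ProjRes X where
  Z n := Nat.rec X (fun _ Y => E.syzygy Y) n
  P n := (E.presentation (Nat.rec X (fun _ Y => E.syzygy Y) n)).P
  i n := (E.presentation (Nat.rec X (fun _ Y => E.syzygy Y) n)).i
  p n := (E.presentation (Nat.rec X (fun _ Y => E.syzygy Y) n)).p
  zero _ := Presentation.zero _
  exact _ := Presentation.exact _
  projective _ := Presentation.projective _
  aug := rfl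

/-- The relative extension group `Ext_E^n(X, B) = H^n(Hom(P, B))`. -/
abbrev Ext (n : ℕ) (X B : C) : Type v := (E.resolution X).cohomology B n

/-- The `E`-projective dimension (`⊤` if infinite). -/
def pd (X : C) : ℕ∞ :=
  ⨅ (n : ℕ) (_ : ∀ j > n, ∀ Z : C, Subsingleton (E.Ext j X Z)), (n : ℕ∞)

/-- The `E`-injective dimension (`⊤` if infinite). -/
def injd (X : C) : ℕ∞ :=
  ⨅ (n : ℕ) (_ : ∀ j > n, ∀ Z : C, Subsingleton (E.Ext j Z X)), (n : ℕ∞)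

/-- The `E`-injective dimension of a class of objects. -/
def injdClass (Y : C → Prop) : ℕ∞ := ⨆ (X : C) (_ : Y X), E.injd X

/-- The finitistic `E`-projective dimension of a class of objects. -/
def fpd (Y : C → Prop) : ℕ∞ := ⨆ (X : C) (_ : Y X) (_ : E.pd X < ⊤), E.pd X

end Basic

/-! ## The stable category -/

section Stable

variable {C : Type u} [Category.{v} C] [Preadditive C] [HasZeroObject C] [HasBinaryBiproducts C]
  (E : ExactStructure C)

/-- The morphism `f` factors through an `E`-projective object. -/
def Factors {X Y : C} (f : X ⟶ Y) : Prop :=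
  ∃ (P : C) (a : X ⟶ P) (b : P ⟶ Y), E.IsProjective P ∧ a ≫ b = f

theorem isProjective_biprod {P Q : C} (hP : E.IsProjective P) (hQ : E.IsProjective Q) :
    E.IsProjective (P ⊞ Q) := by
  intro S hS f
  obtain ⟨a, ha⟩ := hP S hS (biprod.inl ≫ f)
  obtain ⟨b, hb⟩ := hQ S hS (biprod.inr ≫ f)
  exact ⟨biprod.desc a b, by ext <;> simp [ha, hb]⟩

theorem factors_zero (X Y : C) : E.Factors (0 : X ⟶ Y) := by
  open ZeroObject in
  exact ⟨0, 0, 0, E.isProjective_of_isZero (isZero_zero C), by simp⟩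

theorem Factors.add {X Y : C} {f g : X ⟶ Y} (hf : E.Factors f) (hg : E.Factors g) :
    E.Factors (f + g) := by
  obtain ⟨P, a, b, hP, rfl⟩ := hf
  obtain ⟨Q, c, d, hQ, rfl⟩ := hg
  exact ⟨P ⊞ Q, biprod.lift a c, biprod.desc b d, E.isProjective_biprod hP hQ, by simp⟩

theorem Factors.neg {X Y : C} {f : X ⟶ Y} (hf : E.Factors f) : E.Factors (-f) := by
  obtain ⟨P, a, b, hP, rfl⟩ := hf
  exact ⟨P, -a, b, hP, by simp⟩

/-- Two parallel morphisms are identified when their difference factors through a projective. -/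
def stableRel : HomRel C := fun _ _ f g => E.Factors (f - g)

instance stableRel_congruence : Congruence E.stableRel where
  equivalence :=
    { refl := fun f => by
        change E.Factors (f - f)
        rw [sub_self]
        exact E.factors_zero _ _
      symm := fun {f g} h => by
        have := Factors.neg E h
        rwa [neg_sub] at this
      trans := fun {f g k} h h' => by
        have := Factors.add E h h'
        rwa [sub_add_sub_cancel] at this }
  comp_left := by
    intro _ _ _ f g g' h
    obtain ⟨P, a, b, hP, hab⟩ := h
    exact ⟨P, f ≫ a, b, hP, by rw [Category.assoc, hab, Preadditive.comp_sub]⟩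
  comp_right := by
    intro _ _ _ f f' g h
    obtain ⟨P, a, b, hP, hab⟩ := h
    exact ⟨P, a, b ≫ g, hP, by rw [← Category.assoc, hab, Preadditive.sub_comp]⟩

theorem stableRel_add ⦃X Y : C⦄ (f₁ f₂ g₁ g₂ : X ⟶ Y) (h : E.stableRel f₁ f₂)
    (h' : E.stableRel g₁ g₂) : E.stableRel (f₁ + g₁) (f₂ + g₂) := by
  have := Factors.add E h h'
  rwa [← add_sub_add_comm] at this

/-- The stable category of `C` modulo `E`-projectives. -/
abbrev StableCat := CategoryTheory.Quotient E.stableRel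

/-- The projection to the stable category. -/
abbrev toStable : C ⥤ E.StableCat := CategoryTheory.Quotient.functor E.stableRel

instance stablePreadditive : Preadditive E.StableCat :=
  CategoryTheory.Quotient.preadditive E.stableRel E.stableRel_add

instance toStable_additive : E.toStable.Additive :=
  CategoryTheory.Quotient.functor_additive E.stableRel E.stableRel_add

instance stable_hasBinaryBiproducts : HasBinaryBiproducts E.StableCat where
  has_binary_biproduct X Y :=
    have := preservesBinaryBiproducts_of_preservesBiproducts E.toStable
    (inferInstance : HasBinaryBiproduct (E.toStable.obj X.as) (E.toStable.obj Y.as))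

end Stable

/-! ## The group `K_E(C)` and the syzygy endomorphism -/

section KGroup

variable {C : Type u} [Category.{v} C] [Preadditive C] [HasZeroObject C] [HasBinaryBiproducts C]
  (E : ExactStructure C)

/-- The iso-class of an object. -/
abbrev isoClass (M : C) : _root_.Quotient (isIsomorphicSetoid C) := Quotient.mk _ M

/-- The relations `[N] - [S] - [T]` for `N ≅ S ⊞ T`, and `[P]` for `P` an `E`-projective. -/
inductive Relation : FreeAbelianGroup (_root_.Quotient (isIsomorphicSetoid C)) → Prop
  | sum (N S T : C) (e : N ≅ S ⊞ T) : Relation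
      (FreeAbelianGroup.of (isoClass N) - FreeAbelianGroup.of (isoClass S)
        - FreeAbelianGroup.of (isoClass T))
  | proj (P : C) (h : E.IsProjective P) : Relation (FreeAbelianGroup.of (isoClass P))

/-- The group `K_E(C)`: the free abelian group on iso-classes of objects modulo the relations. -/
abbrev KGroup : Type u :=
  FreeAbelianGroup (_root_.Quotient (isIsomorphicSetoid C)) ⧸
    AddSubgroup.closure {x | E.Relation x}

/-- The class of an object in `K_E(C)`. -/
def cls (M : C) : E.KGroup := QuotientAddGroup.mk (FreeAbelianGroup.of (isoClass M))

theorem cls_sum {N S T : C} (e : N ≅ S ⊞ T) : E.cls N = E.cls S + E.cls T := by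
  have h : (QuotientAddGroup.mk (FreeAbelianGroup.of (isoClass N)
      - FreeAbelianGroup.of (isoClass S) - FreeAbelianGroup.of (isoClass T)) : E.KGroup) = 0 :=
    (QuotientAddGroup.eq_zero_iff _).2 (AddSubgroup.subset_closure (Relation.sum N S T e))
  have h' : E.cls N - E.cls S - E.cls T = 0 := h
  rw [sub_sub, sub_eq_zero] at h'
  exact h'

theorem cls_proj {P : C} (h : E.IsProjective P) : E.cls P = 0 :=
  (QuotientAddGroup.eq_zero_iff _).2 (AddSubgroup.subset_closure (Relation.proj P h))

theorem cls_iso {M N : C} (e : M ≅ N) : E.cls M = E.cls N := by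
  unfold cls isoClass
  rw [show (Quotient.mk _ M : _root_.Quotient (isIsomorphicSetoid C)) = Quotient.mk _ N from
    Quotient.sound ⟨e⟩]

/-- Half of Schanuel's lemma: the pullback of `p` along a map that lifts through `p`. -/
theorem pullback_iso {K P X Q W : C} {i : K ⟶ P} {p : P ⟶ X} (w : i ≫ p = 0)
    (hi : IsLimit (KernelFork.ofι i w)) {q : Q ⟶ X} {s : Q ⟶ P} (hs : s ≫ p = q)
    {a : W ⟶ P} {b : W ⟶ Q} (sq : IsPullback a b p q) : Nonempty (W ≅ K ⊞ Q) := by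
  obtain ⟨l, hl⟩ := KernelFork.IsLimit.lift' hi (a - b ≫ s)
    (by simp [hs, sq.w])
  have hl : l ≫ i = a - b ≫ s := hl
  have hmono : ∀ {T : C} (x y : T ⟶ K), x ≫ i = y ≫ i → x = y := fun x y h =>
    Fork.IsLimit.hom_ext hi h
  let k : K ⟶ W := sq.lift i 0 (by simp [w])
  let t : Q ⟶ W := sq.lift s (𝟙 Q) (by simp [hs])
  have ka : k ≫ a = i := sq.lift_fst _ _ _
  have kb : k ≫ b = 0 := sq.lift_snd _ _ _
  have ta : t ≫ a = s := sq.lift_fst _ _ _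
  have tb : t ≫ b = 𝟙 Q := sq.lift_snd _ _ _
  refine ⟨⟨biprod.lift l b, biprod.desc k t, ?_, ?_⟩⟩
  · apply sq.hom_ext
    · simp [ka, ta, hl]
    · simp [kb, tb]
  · have kl : k ≫ l = 𝟙 K := hmono _ _ (by
      rw [Category.assoc, hl, Preadditive.comp_sub, reassoc_of% kb, ka]; simp)
    have tl : t ≫ l = 0 := hmono _ _ (by
      rw [Category.assoc, hl, Preadditive.comp_sub, reassoc_of% tb, ta]; simp)
    ext <;> simp [kl, tl, kb, tb]

/-- Schanuel's lemma. -/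
theorem schanuel {X K L P Q : C} {i : K ⟶ P} {p : P ⟶ X} {j : L ⟶ Q} {q : Q ⟶ X}
    (w : i ≫ p = 0) (hE : E.IsExact (ShortComplex.mk i p w))
    (w' : j ≫ q = 0) (hj : IsLimit (KernelFork.ofι j w'))
    {s : Q ⟶ P} (hs : s ≫ p = q) {t : P ⟶ Q} (ht : t ≫ q = p) :
    Nonempty (K ⊞ Q ≅ L ⊞ P) := by
  obtain ⟨W, a, b, sq, -⟩ := E.pullback_epic p q ⟨K, i, w, hE⟩
  obtain ⟨hi⟩ := E.kernel _ hE
  obtain ⟨e⟩ := pullback_iso w hi hs sq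
  obtain ⟨e'⟩ := pullback_iso w' hj ht sq.flip
  exact ⟨e.symm ≪≫ e'⟩

theorem cls_eq_of_kernel {X : C} (r : E.Presentation X) {L Q : C} {j : L ⟶ Q} {q : Q ⟶ X}
    (w' : j ≫ q = 0) (hj : IsLimit (KernelFork.ofι j w')) (hQ : E.IsProjective Q)
    (hlift : ∀ f : r.P ⟶ X, ∃ g : r.P ⟶ Q, g ≫ q = f) : E.cls L = E.cls r.K := by
  obtain ⟨s, hs⟩ := hQ _ r.exact q
  obtain ⟨t, ht⟩ := hlift r.p
  obtain ⟨e⟩ := E.schanuel r.zero r.exact w' hj hs ht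
  have h := (E.cls_sum (Iso.refl (r.K ⊞ Q))).symm.trans
    ((E.cls_iso e).trans (E.cls_sum (Iso.refl (L ⊞ r.P))))
  rw [E.cls_proj hQ, E.cls_proj r.projective, add_zero, add_zero] at h
  exact h.symm

variable [E.EnoughProjectives]

theorem cls_presentation {X : C} (r : E.Presentation X) : E.cls r.K = E.cls (E.syzygy X) :=
  E.cls_eq_of_kernel (E.presentation X) r.zero (E.kernel _ r.exact).some r.projective
    fun f => (E.presentation X).projective _ r.exact f

theorem cls_syzygy_iso {X Y : C} (e : X ≅ Y) : E.cls (E.syzygy X) = E.cls (E.syzygy Y) := by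
  let r := E.presentation X
  have w : r.i ≫ r.p ≫ e.hom = 0 := by rw [← Category.assoc, r.zero, zero_comp]
  exact E.cls_presentation (X := Y)
    { K := r.K, P := r.P, i := r.i, p := r.p ≫ e.hom, zero := w, projective := r.projective
      exact := E.of_iso (ShortComplex.mk r.i r.p r.zero) _ ⟨ShortComplex.isoMk (Iso.refl _) (Iso.refl _) e (by simp) (by simp)⟩
        r.exact }

theorem cls_syzygy_proj {P : C} (h : E.IsProjective P) : E.cls (E.syzygy P) = 0 := by
  obtain ⟨Z, i, w, hE⟩ := E.id_epic P
  have hi : i = 0 := by simpa using w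
  have hZ : IsZero Z := by
    rw [IsZero.iff_id_eq_zero]
    exact Fork.IsLimit.hom_ext (E.kernel _ hE).some (by simp [hi])
  have := E.cls_presentation (X := P) ⟨Z, P, i, 𝟙 P, w, hE, h⟩
  rw [← this]
  exact E.cls_proj (E.isProjective_of_isZero hZ)

theorem cls_syzygy_biprod (S T : C) :
    E.cls (E.syzygy (S ⊞ T)) = E.cls (E.syzygy S) + E.cls (E.syzygy T) := by
  let r := E.presentation S
  let r' := E.presentation T
  have hr := (E.kernel _ r.exact).some
  have hr' := (E.kernel _ r'.exact).some
  have w : biprod.map r.i r'.i ≫ biprod.map r.p r'.p = 0 := by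
    ext <;> simp [r.zero, r'.zero]
  have hj : IsLimit (KernelFork.ofι (biprod.map r.i r'.i) w) :=
    KernelFork.IsLimit.ofι _ _
      (fun g hg => biprod.lift
        (KernelFork.IsLimit.lift' hr (g ≫ biprod.fst) (by
          have := congrArg (fun x => x ≫ biprod.fst) hg
          simpa using this)).1
        (KernelFork.IsLimit.lift' hr' (g ≫ biprod.snd) (by
          have := congrArg (fun x => x ≫ biprod.snd) hg
          simpa using this)).1)
      (fun g hg => by
        ext
        · simpa using (KernelFork.IsLimit.lift' hr (g ≫ biprod.fst) _).2
        · simpa using (KernelFork.IsLimit.lift' hr' (g ≫ biprod.snd) _).2)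
      (fun g hg m hm => by
        ext
        · refine Fork.IsLimit.hom_ext hr ?_
          have h1 := (KernelFork.IsLimit.lift' hr (g ≫ biprod.fst) (by
            have := congrArg (fun x => x ≫ biprod.fst) hg
            simpa using this)).2
          simp only [biprod.lift_fst]
          refine Eq.trans ?_ h1.symm
          simp [← hm]
        · refine Fork.IsLimit.hom_ext hr' ?_
          have h1 := (KernelFork.IsLimit.lift' hr' (g ≫ biprod.snd) (by
            have := congrArg (fun x => x ≫ biprod.snd) hg
            simpa using this)).2
          simp only [biprod.lift_snd]
          refine Eq.trans ?_ h1.symm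
          simp [← hm])
  have key := E.cls_eq_of_kernel (E.presentation (S ⊞ T)) w hj
    (E.isProjective_biprod r.projective r'.projective) (fun f => by
      obtain ⟨a, ha⟩ := (E.presentation (S ⊞ T)).projective _ r.exact (f ≫ biprod.fst)
      obtain ⟨b, hb⟩ := (E.presentation (S ⊞ T)).projective _ r'.exact (f ≫ biprod.snd)
      exact ⟨biprod.lift a b, by
        ext
        · simpa using ha
        · simpa using hb⟩)
  exact key.symm.trans (E.cls_sum (Iso.refl (r.K ⊞ r'.K)))

/-- The endomorphism `Ω_E` of `K_E(C)`, `[M] ↦ [Ω_E(M)]`. -/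
def omega : E.KGroup →+ E.KGroup :=
  QuotientAddGroup.lift _
    (FreeAbelianGroup.lift (fun c => Quotient.liftOn c (fun M : C => E.cls (E.syzygy M))
      (fun _ _ h => E.cls_syzygy_iso (Nonempty.some h))))
    ((AddSubgroup.closure_le _).2 (by
      rintro x (⟨N, S, T, e⟩ | ⟨P, h⟩)
      · change FreeAbelianGroup.lift _ _ = 0
        simp only [map_sub, FreeAbelianGroup.lift_apply_of]
        change E.cls (E.syzygy N) - E.cls (E.syzygy S) - E.cls (E.syzygy T) = 0
        rw [E.cls_syzygy_iso e, E.cls_syzygy_biprod]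
        abel
      · change FreeAbelianGroup.lift _ _ = 0
        simp only [FreeAbelianGroup.lift_apply_of]
        exact E.cls_syzygy_proj h))

theorem omega_cls (M : C) : E.omega (E.cls M) = E.cls (E.syzygy M) := by
  change FreeAbelianGroup.lift _ _ = _
  simp only [FreeAbelianGroup.lift_apply_of]
  rfl

end KGroup

/-! ## The relative Igusa-Todorov functions -/

section IT

variable {C : Type u} [Category.{v} C] [Preadditive C] [HasZeroObject C] [HasBinaryBiproducts C]
  [HasFiniteBiproducts C] (E : ExactStructure C)

/-- The subgroup `⟨M⟩` of `K_E(C)` generated by the classes of the indecomposable direct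
summands of `M` in the stable category. -/
def span (M : C) : AddSubgroup E.KGroup :=
  AddSubgroup.closure {x | ∃ X Y : E.StableCat, Indecomposable X ∧
    Nonempty (E.toStable.obj M ≅ X ⊞ Y) ∧ x = E.cls X.as}

/-- The class `add N` of direct summands of finite direct sums of copies of `N`. -/
def addClass (N X : C) : Prop :=
  ∃ (Y : C) (k : ℕ), Nonempty ((⨁ fun _ : Fin k => N) ≅ X ⊞ Y)

variable [E.EnoughProjectives]

/-- The image `Ω_E^m(⟨M⟩)`. -/
def omegaSpan (M : C) (m : ℕ) : AddSubgroup E.KGroup :=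
  (E.span M).map (HPow.hPow (α := AddMonoid.End E.KGroup) E.omega m)

/-- `Φ_E(M)`: the least `k` such that `Ω_E` maps `Ω_E^m(⟨M⟩)` isomorphically onto
`Ω_E^(m+1)(⟨M⟩)` for all `m ≥ k`. If `C` is Krull-Schmidt then `⟨M⟩` is finitely generated,
and such a `k` exists by Fitting's lemma. -/
def Phi (M : C) : ℕ :=
  sInf {k : ℕ | ∀ m ≥ k, Set.BijOn E.omega (E.omegaSpan M m) (E.omegaSpan M (m + 1))}

/-- `Ψ_E(M) = Φ_E(M) + fpd_E(add(Ω_E^(Φ_E(M))(M)))`. -/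
def Psi (M : C) : ℕ∞ := E.Phi M + E.fpd (addClass (E.syzygy^[E.Phi M] M))

/-- The `E`-relative `Φ`-dimension of a class of objects. -/
def PhiDim (Y : C → Prop) : ℕ∞ := ⨆ (X : C) (_ : Y X), (E.Phi X : ℕ∞)

/-- The `E`-relative `Ψ`-dimension of a class of objects. -/
def PsiDim (Y : C → Prop) : ℕ∞ := ⨆ (X : C) (_ : Y X), E.Psi X

end IT

/-- An exact IT-context: a skeletally small Krull-Schmidt exact category with enough
projectives. -/
class IsITContext {C : Type u} [Category.{v} C] [Preadditive C] [HasFiniteBiproducts C]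
    (E : ExactStructure C) : Prop extends E.EnoughProjectives where
  essentiallySmall : EssentiallySmall.{w} C
  krullSchmidt : IsKrullSchmidt C

/-! ## The maximal exact structure of an abelian category -/

section Abelian

variable (C : Type u) [Category.{v} C] [Abelian C]

variable {C} in
theorem exists_cokernel_iff_mono {A B : C} (i : A ⟶ B) :
    (∃ (Z : C) (p : B ⟶ Z) (h : i ≫ p = 0), (ShortComplex.mk i p h).ShortExact) ↔ Mono i := by
  constructor
  · rintro ⟨Z, p, h, hE⟩
    exact hE.mono_f
  · intro hi
    exact ⟨_, cokernel.π i, cokernel.condition i,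
      { exact := ShortComplex.exact_of_g_is_cokernel _ (cokernelIsCokernel i)
        mono_f := hi
        epi_g := by dsimp; infer_instance }⟩

variable {C} in
theorem exists_kernel_iff_epi {A B : C} (p : A ⟶ B) :
    (∃ (Z : C) (i : Z ⟶ A) (h : i ≫ p = 0), (ShortComplex.mk i p h).ShortExact) ↔ Epi p := by
  constructor
  · rintro ⟨Z, i, h, hE⟩
    exact hE.epi_g
  · intro hp
    exact ⟨_, kernel.ι p, kernel.condition p,
      { exact := ShortComplex.exact_of_f_is_kernel _ (kernelIsKernel p)
        mono_f := by dsimp; infer_instance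
        epi_g := hp }⟩

/-- The exact structure on an abelian category given by all short exact sequences. -/
def maxExact : ExactStructure C where
  IsExact S := S.ShortExact
  kernel S h := ⟨h.fIsKernel⟩
  cokernel S h := ⟨h.gIsCokernel⟩
  of_iso S T e h := ShortComplex.shortExact_of_iso e.some h
  id_monic A := (exists_cokernel_iff_mono _).2 inferInstance
  id_epic A := (exists_kernel_iff_epi _).2 inferInstance
  comp_monic i j hi hj := by
    rw [exists_cokernel_iff_mono] at hi hj ⊢
    exact mono_comp i j
  comp_epic p q hp hq := by
    have h := (exists_kernel_iff_epi p).1 hp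
    have h' := (exists_kernel_iff_epi q).1 hq
    exact (exists_kernel_iff_epi (p ≫ q)).2 (epi_comp p q)
  pushout_monic i f hi := by
    have h := (exists_cokernel_iff_mono i).1 hi
    exact ⟨_, pushout.inl i f, pushout.inr i f, IsPushout.of_hasPushout i f,
      (exists_cokernel_iff_mono _).2 inferInstance⟩
  pullback_epic p f hp := by
    have h := (exists_kernel_iff_epi p).1 hp
    exact ⟨_, pullback.fst p f, pullback.snd p f, IsPullback.of_hasPullback p f,
      (exists_kernel_iff_epi _).2 inferInstance⟩

instance maxExact_enoughProjectives [CategoryTheory.EnoughProjectives C] :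
    (maxExact C).EnoughProjectives where
  presentation X := by
    obtain ⟨K, i, w, h⟩ := (exists_kernel_iff_epi (Projective.π X)).2 inferInstance
    exact ⟨⟨K, _, i, Projective.π X, w, h, fun S hS f => by
      have : S.ShortExact := hS
      have := this.epi_g
      exact ⟨Projective.factorThru f S.g, Projective.factorThru_comp f S.g⟩⟩⟩

end Abelian

end ExactStructure

/-! ## Finitely generated modules over an artin algebra -/

section Artin

/-- An artin algebra (a module-finite algebra over a commutative artinian ring) is a left
noetherian ring. -/
theorem isNoetherianRing_of_artinAlgebra (R : Type w) [CommRing R] [IsArtinianRing R]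
    (Λ : Type u) [Ring Λ] [Algebra R Λ] [Module.Finite R Λ] : IsNoetherianRing Λ :=
  isNoetherian_of_tower R inferInstance

variable (Λ : Type u) [Ring Λ] [IsNoetherianRing Λ]

instance fgModuleCat_enoughProjectives : EnoughProjectives (FGModuleCat.{u} Λ) where
  presentation X := by
    obtain ⟨n, f, hf⟩ := Module.Finite.exists_fin' Λ X
    have hP : Projective (FGModuleCat.of Λ (Fin n → Λ)) := by
      constructor
      intro A B g e he
      have hs : Function.Surjective e.hom.hom := by
        have : Epi ((forget₂ (FGModuleCat.{u} Λ) (ModuleCat.{u} Λ)).map e) := inferInstance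
        exact (ModuleCat.epi_iff_surjective _).1 this
      obtain ⟨h, hh⟩ := Module.projective_lifting_property e.hom.hom g.hom.hom hs
      exact ⟨FGModuleCat.ofHom h, FGModuleCat.hom_ext hh⟩
    have hE : Epi (FGModuleCat.ofHom f) := by
      have : Epi ((forget₂ (FGModuleCat.{u} Λ) (ModuleCat.{u} Λ)).map (FGModuleCat.ofHom f)) :=
        (ModuleCat.epi_iff_surjective _).2 hf
      exact Functor.epi_of_epi_map (forget₂ (FGModuleCat.{u} Λ) (ModuleCat.{u} Λ)) this
    exact ⟨{ p := FGModuleCat.of Λ (Fin n → Λ), f := FGModuleCat.ofHom f }⟩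

/-- The projective dimension of a finitely generated module (`⊤` if infinite). -/
def modPd (M : FGModuleCat.{u} Λ) : ℕ∞ :=
  ⨅ (n : ℕ) (_ : HasProjectiveDimensionLE M n), (n : ℕ∞)

/-- The finitistic dimension of `Λ`. -/
def finDim : ℕ∞ := ⨆ (M : FGModuleCat.{u} Λ) (_ : modPd Λ M < ⊤), modPd Λ M

/-- The injective dimension of the left regular module `Λ` in the category of finitely
generated modules (`⊤` if infinite). -/
def selfInjDim : ℕ∞ :=
  ⨅ (n : ℕ) (_ : HasInjectiveDimensionLE (FGModuleCat.of Λ Λ) n), (n : ℕ∞)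

/-- The `Φ`-dimension of `Λ`. -/
def algPhiDim : ℕ∞ := (ExactStructure.maxExact (FGModuleCat.{u} Λ)).PhiDim fun _ => True

/-- The `Ψ`-dimension of `Λ`. -/
def algPsiDim : ℕ∞ :=
  haveI : HasFiniteBiproducts (FGModuleCat.{u} Λ) := Abelian.hasFiniteBiproducts
  (ExactStructure.maxExact (FGModuleCat.{u} Λ)).PsiDim fun _ => True

end Artin

end

/-!
Everything is controlled by one vanishing condition. For an object `X` with presentation
`0 → ΩX → P → X → 0`, the group `Ext_E^1(X, B)` vanishes exactly when every morphism `ΩX ⟶ B`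
extends to `P` (`Presentation.Extends`), and `Ext_E^(j+1)(X, B)` vanishes exactly when this holds
for the `j`-th syzygy of `X`. Hence `pd_E(X) ≤ n` if and only if `Ω^n X` is projective, and
`id_E(P(E)) ≤ n` says that no object has extensions by projectives above degree `n`.

The objects that have to be compared with `M` (syzygies for other presentations, objects of
`add M`, stable summands of `M`, and finite sums of these) all lie in the additive closure of `M`
in the stable category. This relation (`StableAdd`) is stated by means of morphisms of `C` only;
it passes to syzygies and transports the vanishing of extensions.

In a Krull-Schmidt category objects can be cancelled from direct sums, as objects with local
endomorphism ring can. So `[X] = [Y]` holds in `K_E(C)` only if `X` and `Y` are isomorphic up to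
projective summands (`exists_iso_of_cls_eq`); in particular `[X] = 0` only if `X` is projective.

* If `pd_E(M)` is finite, then `Ω_E` annihilates all of `⟨M⟩` after finitely many steps, and from
  degree `Φ_E(M)` on it is injective, so that already `[Ω^Φ M] = 0`. Thus `pd_E(M) ≤ Φ_E(M)`
  (`pd_le_phi`).
* Suppose that `M` has no extensions by projectives above degree `n`. For `m ≥ n` an element of
  `Ω^m⟨M⟩` has the form `[A] - [B]` where `A` and `B` have no extensions by projectives. If
  `[ΩA] = [ΩB]`, then the dual of Schanuel's lemma, applied to the embeddings of `ΩA` and `ΩB` into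
  projectives, gives `[A] = [B]` (`cls_eq_of_cls_K_eq`). So `Ω_E` is injective there, and
  `Φ_E(M) ≤ n`. An object `X` of `add (Ω^Φ M)` has no extensions by projectives above degree
  `n - Φ_E(M)`; if `pd_E(X)` is finite, then it is at most `n - Φ_E(M)`, because the last syzygies
  split off (`pd_le_of_extends`). Hence `Ψ_E(M) ≤ n` (`psi_le_of_extends`). With
  `n = id_E(P(E))` this bounds `Ψ_E` on `C`; on `n`-th syzygies it applies with `0` in place of `n`.

For modules over an artin algebra, Fitting's lemma gives the Krull-Schmidt property, and the
dimensions defined by Yoneda extensions are compared with the relative ones by dimension shifting.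
-/

noncomputable section

theorem iInf_natCast_le_iff {p : ℕ → Prop} (hp : ∀ m n, m ≤ n → p m → p n) (n : ℕ) :
    (⨅ (k : ℕ) (_ : p k), (k : ℕ∞)) ≤ n ↔ p n := by
  constructor
  · intro h
    by_contra hn
    have : ((n + 1 : ℕ) : ℕ∞) ≤ ⨅ (k : ℕ) (_ : p k), (k : ℕ∞) :=
      le_iInf₂ fun k hk => by
        by_contra hlt
        exact hn (hp k n (by norm_cast at hlt; omega) hk)
    have := this.trans h
    norm_cast at this
    omega
  · exact fun h => iInf₂_le n h

namespace ExactStructure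

/-! ### Relative extensions and syzygies -/

section Ext

variable {C : Type u} [Category.{v} C] [Preadditive C] {E : ExactStructure C}

theorem epi_of_isExact {S : ShortComplex C} (h : E.IsExact S) : Epi S.g :=
  Cofork.IsColimit.epi (E.cokernel S h).some

theorem mono_of_isExact {S : ShortComplex C} (h : E.IsExact S) : Mono S.f :=
  Fork.IsLimit.mono (E.kernel S h).some

theorem IsProjective.of_retract {P Q : C} (hP : E.IsProjective P) (i : Q ⟶ P) (r : P ⟶ Q)
    (h : i ≫ r = 𝟙 Q) : E.IsProjective Q := by
  intro S hS f
  obtain ⟨g, hg⟩ := hP S hS (r ≫ f)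
  exact ⟨i ≫ g, by rw [Category.assoc, hg, ← Category.assoc, h, Category.id_comp]⟩

namespace Presentation

variable {X : C} (r : E.Presentation X)

instance : Epi r.p := epi_of_isExact r.exact

instance : Mono r.i := mono_of_isExact r.exact

theorem exists_lift {T : C} (f : T ⟶ r.P) (hf : f ≫ r.p = 0) : ∃ g : T ⟶ r.K, g ≫ r.i = f :=
  have l := KernelFork.IsLimit.lift' (E.kernel _ r.exact).some f hf
  ⟨l.1, l.2⟩

theorem exists_desc {T : C} (f : r.P ⟶ T) (hf : r.i ≫ f = 0) : ∃ g : X ⟶ T, r.p ≫ g = f :=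
  have l := CokernelCofork.IsColimit.desc' (E.cokernel _ r.exact).some f hf
  ⟨l.1, l.2⟩

/-- Every morphism from the syzygy `r.K` to `B` extends to the projective `r.P`. This says that
`Ext_E^1(X, B)` vanishes, and it does not depend on the presentation `r` of `X`. -/
def Extends (B : C) : Prop := ∀ g : r.K ⟶ B, ∃ h : r.P ⟶ B, r.i ≫ h = g

theorem Extends.of_retract {r : E.Presentation X} {B B' : C} (h : r.Extends B) (i : B' ⟶ B)
    (s : B ⟶ B') (his : i ≫ s = 𝟙 B') : r.Extends B' := fun g => by
  obtain ⟨k, hk⟩ := h (g ≫ i)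
  exact ⟨k ≫ s, by rw [← Category.assoc, hk, Category.assoc, his, Category.comp_id]⟩

/-- If `Ext_E^1(X, ΩX) = 0` then the presentation splits. -/
theorem isProjective_of_extends (h : r.Extends r.K) : E.IsProjective X := by
  obtain ⟨ρ, hρ⟩ := h (𝟙 _)
  obtain ⟨s, hs⟩ := r.exists_desc (𝟙 _ - ρ ≫ r.i) (by
    rw [Preadditive.comp_sub, ← Category.assoc, hρ]; simp)
  refine r.projective.of_retract s r.p ?_
  rw [← cancel_epi r.p, ← Category.assoc, hs, Preadditive.sub_comp, Category.assoc, r.zero]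
  simp

theorem exists_retraction (h : E.IsProjective X) : ∃ ρ : r.P ⟶ r.K, r.i ≫ ρ = 𝟙 _ := by
  obtain ⟨s, hs⟩ := h _ r.exact (𝟙 X)
  have hs : s ≫ r.p = 𝟙 X := hs
  obtain ⟨ρ, hρ⟩ := r.exists_lift (𝟙 _ - r.p ≫ s) (by simp [hs])
  refine ⟨ρ, ?_⟩
  rw [← cancel_mono r.i, Category.assoc, hρ, Preadditive.comp_sub, ← Category.assoc, r.zero]
  simp

theorem extends_of_isProjective (h : E.IsProjective X) (B : C) : r.Extends B := fun g => by
  obtain ⟨ρ, hρ⟩ := r.exists_retraction h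
  exact ⟨ρ ≫ g, by rw [← Category.assoc, hρ, Category.id_comp]⟩

theorem isProjective_K (h : E.IsProjective X) : E.IsProjective r.K :=
  have ⟨ρ, hρ⟩ := r.exists_retraction h
  r.projective.of_retract r.i ρ hρ

end Presentation

/-- In positive degree, the cohomology of `Hom(P, B)` is the group of morphisms
`Z (j + 1) ⟶ B` modulo those that extend to `P j`. -/
theorem ProjRes.subsingleton_cohomology_succ_iff {X : C} (R : E.ProjRes X) (B : C) (j : ℕ) :
    Subsingleton (R.cohomology B (j + 1)) ↔ ∀ g : R.Z (j + 1) ⟶ B, ∃ h, R.i j ≫ h = g := by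
  have hepi : ∀ n, Epi (R.p n) := fun n => epi_of_isExact (R.exact n)
  rw [QuotientAddGroup.subsingleton_iff, AddSubgroup.addSubgroupOf_eq_top]
  constructor
  · intro H g
    have hg : R.p (j + 1) ≫ g ∈ (R.dHom B (j + 1)).ker := by
      change (R.p (j + 1 + 1) ≫ R.i (j + 1)) ≫ R.p (j + 1) ≫ g = 0
      rw [Category.assoc, ← Category.assoc (R.i (j + 1)), R.zero]
      simp
    obtain ⟨h, hh⟩ := H hg
    have hh : (R.p (j + 1) ≫ R.i j) ≫ h = R.p (j + 1) ≫ g := hh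
    rw [Category.assoc, cancel_epi] at hh
    exact ⟨h, hh⟩
  · intro H f hf
    have hf : (R.p (j + 1 + 1) ≫ R.i (j + 1)) ≫ f = 0 := hf
    rw [Category.assoc, ← comp_zero (f := R.p (j + 1 + 1)), cancel_epi] at hf
    obtain ⟨g, hg⟩ := CokernelCofork.IsColimit.desc' (E.cokernel _ (R.exact (j + 1))).some f hf
    have hg : R.p (j + 1) ≫ g = f := hg
    obtain ⟨h, rfl⟩ := H g
    exact ⟨h, by rw [← hg]; exact Category.assoc _ _ _⟩

variable (E) [E.EnoughProjectives]

theorem resolution_Z (X : C) (n : ℕ) : (E.resolution X).Z n = E.syzygy^[n] X := by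
  induction n with
  | zero => rfl
  | succ n ih => rw [Function.iterate_succ_apply', ← ih]; rfl

theorem subsingleton_ext_succ_iff (X B : C) (j : ℕ) :
    Subsingleton (E.Ext (j + 1) X B) ↔ (E.presentation (E.syzygy^[j] X)).Extends B := by
  rw [Ext, ProjRes.subsingleton_cohomology_succ_iff, ← E.resolution_Z]
  rfl

theorem isProjective_syzygy {X : C} (h : E.IsProjective X) : E.IsProjective (E.syzygy X) :=
  (E.presentation X).isProjective_K h

theorem isProjective_iterate_syzygy {X : C} {m n : ℕ} (hmn : m ≤ n)
    (h : E.IsProjective (E.syzygy^[m] X)) : E.IsProjective (E.syzygy^[n] X) := by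
  induction n, hmn using Nat.le_induction with
  | base => exact h
  | succ n _ ih => rw [Function.iterate_succ_apply']; exact E.isProjective_syzygy ih

theorem pd_le_iff_forall (X : C) (n : ℕ) :
    E.pd X ≤ n ↔ ∀ j ≥ n, ∀ B, (E.presentation (E.syzygy^[j] X)).Extends B := by
  rw [pd, iInf_natCast_le_iff fun m n hmn h j hj => h j (by omega)]
  simp only [← subsingleton_ext_succ_iff]
  exact ⟨fun h j hj B => h _ (by omega) B, fun h j hj B => by
    obtain ⟨j, rfl⟩ := Nat.exists_eq_succ_of_ne_zero (by omega : j ≠ 0)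
    exact h j (by omega) B⟩

theorem injd_le_iff (B : C) (n : ℕ) :
    E.injd B ≤ n ↔ ∀ j ≥ n, ∀ X, (E.presentation (E.syzygy^[j] X)).Extends B := by
  rw [injd, iInf_natCast_le_iff fun m n hmn h j hj => h j (by omega)]
  simp only [← subsingleton_ext_succ_iff]
  exact ⟨fun h j hj B => h _ (by omega) B, fun h j hj B => by
    obtain ⟨j, rfl⟩ := Nat.exists_eq_succ_of_ne_zero (by omega : j ≠ 0)
    exact h j (by omega) B⟩

theorem pd_le_iff (X : C) (n : ℕ) : E.pd X ≤ n ↔ E.IsProjective (E.syzygy^[n] X) := by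
  rw [pd_le_iff_forall]
  exact ⟨fun h => (E.presentation _).isProjective_of_extends (h n le_rfl _), fun h j hj B =>
    (E.presentation _).extends_of_isProjective (E.isProjective_iterate_syzygy hj h) B⟩

/-- An object of finite projective dimension which has no extensions by projectives above degree
`n` has projective dimension at most `n`: the last syzygies split off one after the other. -/
theorem pd_le_of_extends {X : C} (hX : E.pd X < ⊤) (n : ℕ)
    (h : ∀ j ≥ n, ∀ P, E.IsProjective P → (E.presentation (E.syzygy^[j] X)).Extends P) :
    E.pd X ≤ n := by
  obtain ⟨d, hd'⟩ := ENat.ne_top_iff_exists.1 hX.ne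
  have hd := (E.pd_le_iff X d).1 hd'.ge
  rw [pd_le_iff]
  rcases le_total d n with hdn | hnd
  · exact E.isProjective_iterate_syzygy hdn hd
  · clear hX hd'
    induction d, hnd using Nat.le_induction with
    | base => exact hd
    | succ d hnd ih =>
      rw [Function.iterate_succ_apply'] at hd
      exact ih ((E.presentation _).isProjective_of_extends (h d hnd _ hd))

end Ext

/-! ### Stable additive closure -/

section StableAdd

variable {C : Type u} [Category.{v} C] [Preadditive C] [HasZeroObject C] [HasBinaryBiproducts C]
  {E : ExactStructure C}

theorem Factors.comp_left {X Y Z : C} (f : X ⟶ Y) {g : Y ⟶ Z} (h : E.Factors g) :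
    E.Factors (f ≫ g) := by
  obtain ⟨P, a, b, hP, rfl⟩ := h
  exact ⟨P, f ≫ a, b, hP, by simp⟩

theorem Factors.comp_right {X Y Z : C} {f : X ⟶ Y} (g : Y ⟶ Z) (h : E.Factors f) :
    E.Factors (f ≫ g) := by
  obtain ⟨P, a, b, hP, rfl⟩ := h
  exact ⟨P, a, b ≫ g, hP, by simp⟩

theorem isProjective_of_factors_id {X : C} (h : E.Factors (𝟙 X)) : E.IsProjective X := by
  obtain ⟨P, a, b, hP, hab⟩ := h
  exact hP.of_retract a b hab

variable (E) in
/-- `X` lies in the additive closure of `M` in the stable category, expressed in `C`: modulo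
morphisms which factor through a projective, the identity of `X` is a finite sum of morphisms
factoring through `M`. -/
def StableAdd (M X : C) : Prop :=
  ∃ (ι : Type) (_ : Fintype ι) (a : ι → (X ⟶ M)) (b : ι → (M ⟶ X)),
    E.Factors (∑ t, a t ≫ b t - 𝟙 X)

theorem StableAdd.of_factors_sub {M X : C} (a : X ⟶ M) (b : M ⟶ X)
    (h : E.Factors (a ≫ b - 𝟙 X)) : E.StableAdd M X :=
  ⟨Unit, inferInstance, fun _ => a, fun _ => b, by simpa using h⟩

theorem StableAdd.of_retract {M X : C} (a : X ⟶ M) (b : M ⟶ X) (h : a ≫ b = 𝟙 X) :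
    E.StableAdd M X :=
  .of_factors_sub a b (by rw [h, sub_self]; exact E.factors_zero _ _)

variable (E) in
theorem StableAdd.refl (M : C) : E.StableAdd M M := .of_retract (𝟙 M) (𝟙 M) (by simp)

theorem StableAdd.of_isZero {M X : C} (h : IsZero X) : E.StableAdd M X :=
  ⟨Empty, inferInstance, Empty.elim, Empty.elim, by
    rw [h.eq_of_src (_ - _) 0]; exact E.factors_zero _ _⟩

theorem StableAdd.retract {M X Y : C} (h : E.StableAdd M Y) (i : X ⟶ Y) (r : Y ⟶ X)
    (hir : i ≫ r = 𝟙 X) : E.StableAdd M X := by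
  obtain ⟨ι, _, a, b, h⟩ := h
  refine ⟨ι, inferInstance, fun t => i ≫ a t, fun t => b t ≫ r, ?_⟩
  have := (h.comp_left i).comp_right r
  simpa [Preadditive.comp_sub, Preadditive.sub_comp, Preadditive.comp_sum, Preadditive.sum_comp,
    hir] using this

theorem StableAdd.biprod {M X Y : C} (hX : E.StableAdd M X) (hY : E.StableAdd M Y) :
    E.StableAdd M (X ⊞ Y) := by
  obtain ⟨ι, _, a, b, h⟩ := hX
  obtain ⟨κ, _, a', b', h'⟩ := hY
  refine ⟨ι ⊕ κ, inferInstance, Sum.elim (fun t => biprod.fst ≫ a t) (fun t => biprod.snd ≫ a' t),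
    Sum.elim (fun t => b t ≫ biprod.inl) (fun t => b' t ≫ biprod.inr), ?_⟩
  have := Factors.add E ((h.comp_left biprod.fst).comp_right biprod.inl)
    ((h'.comp_left biprod.snd).comp_right biprod.inr)
  convert this using 1
  simp only [Fintype.sum_sum_type, Sum.elim_inl, Sum.elim_inr, Preadditive.comp_sub,
    Preadditive.sub_comp, Preadditive.comp_sum, Preadditive.sum_comp, Category.assoc,
    Category.comp_id, ← biprod.total]
  abel

/-- The comparison underlying both ways in which syzygies respect the stable additive closure:
lifts of the given morphisms to presentations induce morphisms of syzygies which exhibit the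
identity of `r.K` as a sum of morphisms through `r'.K`, up to a morphism through `r.i`. -/
theorem StableAdd.exists_lift {M X : C} (h : E.StableAdd M X) (r : E.Presentation X)
    (r' : E.Presentation M) :
    ∃ (ι : Type) (_ : Fintype ι) (a : ι → (r.K ⟶ r'.K)) (a' : ι → (r.P ⟶ r'.P))
      (b : ι → (r'.K ⟶ r.K)) (c : r.P ⟶ r.K), (∀ t, a t ≫ r'.i = r.i ≫ a' t) ∧
      ∑ t, a t ≫ b t - 𝟙 r.K = r.i ≫ c := by
  obtain ⟨ι, _, a, b, Q, c, d, hQ, hcd⟩ := h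
  choose a' ha' using fun t => r.projective _ r'.exact (r.p ≫ a t)
  choose b' hb' using fun t => r'.projective _ r.exact (r'.p ≫ b t)
  obtain ⟨d', hd'⟩ := hQ _ r.exact d
  dsimp only at ha' hb' hd'
  have zero_assoc : ∀ t, r.i ≫ r.p ≫ a t = 0 := fun t => by
    rw [← Category.assoc, r.zero, zero_comp]
  have zero_assoc' : ∀ t, r'.i ≫ r'.p ≫ b t = 0 := fun t => by
    rw [← Category.assoc, r'.zero, zero_comp]
  choose α hα using fun t => r'.exists_lift (r.i ≫ a' t) (by
    rw [Category.assoc, ha', zero_assoc])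
  choose β hβ using fun t => r.exists_lift (r'.i ≫ b' t) (by
    rw [Category.assoc, hb', zero_assoc'])
  -- the lift of `∑ a b - 1` to `r.P` and the lift through `Q` differ by a map into the kernel
  obtain ⟨k, hk⟩ := r.exists_lift (∑ t, a' t ≫ b' t - 𝟙 r.P - r.p ≫ c ≫ d') (by
    have h1 : ∀ t, a' t ≫ b' t ≫ r.p = r.p ≫ a t ≫ b t := fun t => by
      rw [hb', ← Category.assoc, ha', Category.assoc]
    simp only [Preadditive.sub_comp, Preadditive.sum_comp, Category.assoc, h1, hd', hcd]
    simp [Preadditive.comp_sub, Preadditive.comp_sum])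
  refine ⟨ι, inferInstance, α, a', β, k, hα, ?_⟩
  rw [← cancel_mono r.i, Category.assoc, hk]
  have h2 : ∀ t, α t ≫ β t ≫ r.i = r.i ≫ a' t ≫ b' t := fun t => by
    rw [hβ, ← Category.assoc, hα, Category.assoc]
  have h3 : r.i ≫ r.p ≫ c ≫ d' = 0 := by rw [← Category.assoc, r.zero, zero_comp]
  simp only [Preadditive.sub_comp, Preadditive.comp_sub, Preadditive.sum_comp,
    Preadditive.comp_sum, Category.assoc, h2, h3]
  simp

theorem StableAdd.syzygy {M X : C} (h : E.StableAdd M X) (r : E.Presentation X)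
    (r' : E.Presentation M) : E.StableAdd r'.K r.K := by
  obtain ⟨ι, _, a, a', b, c, -, h⟩ := h.exists_lift r r'
  exact ⟨ι, inferInstance, a, b, r.P, r.i, c, r.projective, h.symm⟩

theorem StableAdd.extends {M X : C} (h : E.StableAdd M X) (r : E.Presentation X)
    (r' : E.Presentation M) {B : C} (hB : r'.Extends B) : r.Extends B := by
  obtain ⟨ι, _, a, a', b, c, ha, h⟩ := h.exists_lift r r'
  intro g
  choose e he using fun t => hB (b t ≫ g)
  refine ⟨∑ t, a' t ≫ e t - c ≫ g, ?_⟩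
  have h1 : 𝟙 r.K = ∑ t, a t ≫ b t - r.i ≫ c := by rw [← h]; abel
  have h2 : ∀ t, r.i ≫ a' t ≫ e t = a t ≫ b t ≫ g := fun t => by
    rw [← he, ← Category.assoc, ← ha, Category.assoc]
  conv_rhs => rw [← Category.id_comp g, h1]
  simp only [Preadditive.sub_comp, Preadditive.comp_sub, Preadditive.sum_comp,
    Preadditive.comp_sum, Category.assoc, h2]

variable [E.EnoughProjectives]

theorem StableAdd.iterate_syzygy {M X : C} (h : E.StableAdd M X) (j : ℕ) :
    E.StableAdd (E.syzygy^[j] M) (E.syzygy^[j] X) := by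
  induction j with
  | zero => exact h
  | succ j ih =>
    rw [Function.iterate_succ_apply', Function.iterate_succ_apply']
    exact ih.syzygy _ _

theorem StableAdd.extends_iterate {M X : C} (h : E.StableAdd M X) {j : ℕ} {B : C}
    (hB : (E.presentation (E.syzygy^[j] M)).Extends B) :
    (E.presentation (E.syzygy^[j] X)).Extends B :=
  (h.iterate_syzygy j).extends _ _ hB

theorem IsSyzygy.stableAdd {n : ℕ} {K M : C} (h : E.IsSyzygy n K M) :
    E.StableAdd (E.syzygy^[n] M) K := by
  induction n generalizing K with
  | zero =>
    obtain ⟨e⟩ := h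
    exact .of_retract e.hom e.inv e.hom_inv_id
  | succ n ih =>
    obtain ⟨L, q, hL, ⟨e⟩⟩ := h
    rw [Function.iterate_succ_apply']
    exact ((ih hL).syzygy q _).retract e.hom e.inv e.hom_inv_id

theorem addClass.stableAdd [HasFiniteBiproducts C] {N X : C} (h : addClass N X) :
    E.StableAdd N X := by
  obtain ⟨Y, k, ⟨e⟩⟩ := h
  have : E.StableAdd N (⨁ fun _ : Fin k => N) := by
    refine ⟨Fin k, inferInstance, biproduct.π _, biproduct.ι (fun _ : Fin k => N), ?_⟩
    rw [biproduct.total, sub_self]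
    exact E.factors_zero _ _
  exact this.retract (biprod.inl ≫ e.inv) (e.hom ≫ biprod.fst) (by simp)

end StableAdd

end ExactStructure

/-! ### Krull-Schmidt categories: induction and cancellation -/

section KrullSchmidt

variable {C : Type u} [Category.{v} C] [Preadditive C]

theorem isZero_biproduct_fin_zero [HasFiniteBiproducts C] (f : Fin 0 → C) : IsZero (⨁ f) := by
  rw [IsZero.iff_id_eq_zero]
  ext i
  exact i.elim0

/-- Splitting off the first summand of a finite biproduct. -/
def biproductFinSuccIso [HasBinaryBiproducts C] [HasFiniteBiproducts C] {n : ℕ}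
    (f : Fin (n + 1) → C) : ⨁ f ≅ f 0 ⊞ ⨁ fun i : Fin n => f i.succ where
  hom := biprod.lift (biproduct.π f 0) (biproduct.lift fun i => biproduct.π f i.succ)
  inv := biprod.desc (biproduct.ι f 0) (biproduct.desc fun i => biproduct.ι f i.succ)
  hom_inv_id := by
    rw [biprod.lift_desc, biproduct.lift_desc, ← biproduct.total, Fin.sum_univ_succ]
  inv_hom_id := by
    ext i j
    · simp
    · simp [biproduct.ι_π_ne f (Fin.succ_ne_zero _).symm]
    · simp [biproduct.ι_π_ne f (Fin.succ_ne_zero _)]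
    · by_cases h : i = j
      · subst h; simp
      · simp [biproduct.ι_π_ne f ((Fin.succ_injective _).ne h), biproduct.ι_π_ne _ h]

/-- Induction over a decomposition into objects with local endomorphism rings. -/
theorem IsKrullSchmidt.induction [HasBinaryBiproducts C] [HasFiniteBiproducts C]
    (hC : IsKrullSchmidt C) {p : C → Prop} (iso : ∀ {X Y}, (X ≅ Y) → p X → p Y)
    (zero : ∀ {X}, IsZero X → p X)
    (biprod : ∀ {X Y}, IsLocalRing (End X) → p Y → p (X ⊞ Y)) (X : C) : p X := by
  obtain ⟨n, f, hf, ⟨e⟩⟩ := hC X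
  refine iso e.symm ?_
  clear e
  induction n with
  | zero => exact zero (isZero_biproduct_fin_zero f)
  | succ n ih => exact iso (biproductFinSuccIso f).symm (biprod (hf 0) (ih _ fun i => hf i.succ))

theorem isIso_of_comp_eq_id {Z : C} [hZ : IsLocalRing (End Z)] {a s : Z ⟶ Z} (h : a ≫ s = 𝟙 Z) :
    IsIso a := by
  have hsum : (show End Z from s ≫ a) + (show End Z from 𝟙 Z - s ≫ a) = 1 :=
    add_sub_cancel (s ≫ a) (𝟙 Z)
  rcases IsLocalRing.isUnit_or_isUnit_of_add_one hsum with hu | hu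
  · have : IsIso (s ≫ a) := (isUnit_iff_isIso _).1 hu
    refine ⟨s, h, ?_⟩
    rw [← cancel_epi (s ≫ a), Category.assoc, ← Category.assoc a, h]
    simp
  · have : IsIso (𝟙 Z - s ≫ a) := (isUnit_iff_isIso _).1 hu
    have ha : a = 0 := by
      rw [← cancel_mono (𝟙 Z - s ≫ a), Preadditive.comp_sub, ← Category.assoc, h]
      simp
    have : (1 : End Z) = 0 := by
      change 𝟙 Z = 0
      rw [← h, ha, zero_comp]
    exact absurd this one_ne_zero

/-- Objects with local endomorphism ring can be cancelled: if the `Z`-component of the isomorphism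
is not invertible, it becomes so after an elementary row operation. -/
theorem cancel_of_isLocalRing [HasBinaryBiproducts C] {Z A B : C} (hZ : IsLocalRing (End Z))
    (e : Z ⊞ A ≅ Z ⊞ B) : Nonempty (A ≅ B) := by
  let a : Z ⟶ Z := biprod.inl ≫ e.hom ≫ biprod.fst
  let b : Z ⟶ B := biprod.inl ≫ e.hom ≫ biprod.snd
  let a' : Z ⟶ Z := biprod.inl ≫ e.inv ≫ biprod.fst
  let c : B ⟶ Z := biprod.inr ≫ e.inv ≫ biprod.fst
  have h1 : a ≫ a' + b ≫ c = 𝟙 Z := by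
    have : (biprod.inl ≫ e.hom) ≫ (biprod.fst ≫ biprod.inl + biprod.snd ≫ biprod.inr) ≫
        e.inv ≫ biprod.fst = 𝟙 Z := by simp
    simpa only [Preadditive.add_comp, Preadditive.comp_add, Category.assoc, a, b, a', c] using this
  by_cases ha : IsIso a
  · exact ⟨Biprod.isoElim e⟩
  · have hbc : IsUnit (show End Z from b ≫ c) := by
      refine (IsLocalRing.isUnit_or_isUnit_of_add_one
        (a := (show End Z from a ≫ a')) h1).resolve_left fun hu => ha ?_
      have : IsIso (a ≫ a') := (isUnit_iff_isIso _).1 hu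
      exact isIso_of_comp_eq_id (s := a' ≫ inv (a ≫ a'))
        (by rw [← Category.assoc, IsIso.hom_inv_id])
    have hd : IsIso (a + b ≫ c) := by
      refine (isUnit_iff_isIso _).1 ((IsLocalRing.isUnit_or_isUnit_of_isUnit_add
        (a := (show End Z from a + b ≫ c)) (b := (show End Z from -a)) ?_).resolve_right
        fun hu => ha ?_)
      · have : (show End Z from a + b ≫ c) + (show End Z from -a) = (show End Z from b ≫ c) :=
          add_neg_cancel_comm a (b ≫ c)
        rwa [this]
      · have : IsIso (-a) := (isUnit_iff_isIso _).1 hu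
        exact ⟨-inv (-a), by simp [← Preadditive.neg_comp], by simp [← Preadditive.comp_neg]⟩
    let e' := e ≪≫ Biprod.unipotentLower c
    have : IsIso (biprod.inl ≫ e'.hom ≫ biprod.fst) := by
      have : biprod.inl ≫ e'.hom ≫ biprod.fst = a + b ≫ c := by
        simp [e', a, b, Biprod.ofComponents]
      rw [this]
      exact hd
    exact ⟨Biprod.isoElim e'⟩

theorem IsKrullSchmidt.cancel [HasBinaryBiproducts C] [HasFiniteBiproducts C]
    (hC : IsKrullSchmidt C) (Z : C) : ∀ {A B : C}, (Z ⊞ A ≅ Z ⊞ B) → Nonempty (A ≅ B) := by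
  refine hC.induction (p := fun Z => ∀ {A B : C}, (Z ⊞ A ≅ Z ⊞ B) → Nonempty (A ≅ B))
    ?_ ?_ ?_ Z
  · intro X Y e h A B e'
    exact h (biprod.mapIso e (Iso.refl A) ≪≫ e' ≪≫ biprod.mapIso e.symm (Iso.refl B))
  · intro X hX A B e
    have h (A : C) : X ⊞ A ≅ A :=
      { hom := biprod.snd
        inv := biprod.inr
        hom_inv_id := by
          ext
          · exact hX.eq_of_src _ _
          · exact hX.eq_of_src _ _
          · simp
          · simp
        inv_hom_id := by simp }
    exact ⟨(h A).symm ≪≫ e ≪≫ h B⟩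
  · intro X Y hX h A B e
    obtain ⟨e'⟩ := cancel_of_isLocalRing hX
      ((biprod.associator X Y A).symm ≪≫ e ≪≫ biprod.associator X Y B)
    exact h e'

end KrullSchmidt

namespace ExactStructure

/-! ### Equality in the group `K_E(C)` -/

section KGroup

variable {C : Type u} [Category.{v} C] [Preadditive C] [HasZeroObject C] [HasBinaryBiproducts C]

variable (C) in
/-- The isomorphism classes of objects, as a commutative monoid under direct sum. -/
def IsoClasses : Type u := _root_.Quotient (isIsomorphicSetoid C)

/-- The isomorphism class of an object, as an element of the monoid of classes. -/
def IsoClasses.mk (X : C) : IsoClasses C := isoClass X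

theorem IsoClasses.mk_eq_mk {X Y : C} : mk X = mk Y ↔ Nonempty (X ≅ Y) := Quotient.eq

instance : Add (IsoClasses C) :=
  ⟨Quotient.map₂ (fun X Y => X ⊞ Y) fun _ _ ⟨e⟩ _ _ ⟨e'⟩ => ⟨biprod.mapIso e e'⟩⟩

open ZeroObject in
instance : Zero (IsoClasses C) := ⟨IsoClasses.mk 0⟩

instance : AddCommMonoid (IsoClasses C) where
  add_assoc := by
    rintro ⟨X⟩ ⟨Y⟩ ⟨Z⟩
    exact Quotient.sound ⟨biprod.associator X Y Z⟩
  zero_add := by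
    rintro ⟨X⟩
    exact Quotient.sound ⟨(isoZeroBiprod (isZero_zero C)).symm⟩
  add_zero := by
    rintro ⟨X⟩
    exact Quotient.sound ⟨(isoBiprodZero (isZero_zero C)).symm⟩
  add_comm := by
    rintro ⟨X⟩ ⟨Y⟩
    exact Quotient.sound ⟨biprod.braiding X Y⟩
  nsmul := nsmulRec

theorem IsoClasses.mk_biprod (X Y : C) : mk (X ⊞ Y) = mk X + mk Y := rfl

variable (E : ExactStructure C)

/-- The classes of projectives in the Grothendieck group of the monoid of isomorphism classes. -/
def projSubgroup : AddSubgroup (Algebra.GrothendieckAddGroup (IsoClasses C)) :=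
  AddSubgroup.closure {x | ∃ P, E.IsProjective P ∧
    x = Algebra.GrothendieckAddGroup.of (IsoClasses.mk P)}

/-- The comparison of `K_E(C)` with the Grothendieck group of the monoid of isomorphism classes
modulo projectives, on which equality of classes can be read off. -/
def kGroupToGrothendieck :
    E.KGroup →+ Algebra.GrothendieckAddGroup (IsoClasses C) ⧸ E.projSubgroup :=
  QuotientAddGroup.lift _
    (FreeAbelianGroup.lift fun c =>
      QuotientAddGroup.mk (Algebra.GrothendieckAddGroup.of (show IsoClasses C from c)))
    ((AddSubgroup.closure_le _).2 (by
      rintro x (⟨N, S, T, e⟩ | ⟨P, h⟩)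
      · change FreeAbelianGroup.lift _ _ = 0
        simp only [map_sub, FreeAbelianGroup.lift_apply_of]
        rw [← QuotientAddGroup.mk_sub, ← QuotientAddGroup.mk_sub, QuotientAddGroup.eq_zero_iff]
        change Algebra.GrothendieckAddGroup.of (IsoClasses.mk N) -
          Algebra.GrothendieckAddGroup.of (IsoClasses.mk S) -
          Algebra.GrothendieckAddGroup.of (IsoClasses.mk T) ∈ _
        rw [IsoClasses.mk_eq_mk.2 ⟨e⟩, IsoClasses.mk_biprod, map_add, add_sub_cancel_left,
          sub_self]
        exact zero_mem _
      · change FreeAbelianGroup.lift _ _ = 0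
        simp only [FreeAbelianGroup.lift_apply_of]
        rw [QuotientAddGroup.eq_zero_iff]
        exact AddSubgroup.subset_closure ⟨P, h, rfl⟩))

theorem kGroupToGrothendieck_cls (X : C) : E.kGroupToGrothendieck (E.cls X) =
    QuotientAddGroup.mk (Algebra.GrothendieckAddGroup.of (IsoClasses.mk X)) := by
  change FreeAbelianGroup.lift _ _ = _
  simp only [FreeAbelianGroup.lift_apply_of]
  rfl

theorem exists_of_mem_projSubgroup {x : Algebra.GrothendieckAddGroup (IsoClasses C)}
    (hx : x ∈ E.projSubgroup) : ∃ P Q, E.IsProjective P ∧ E.IsProjective Q ∧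
      x = Algebra.GrothendieckAddGroup.of (IsoClasses.mk P) -
        Algebra.GrothendieckAddGroup.of (IsoClasses.mk Q) := by
  induction hx using AddSubgroup.closure_induction with
  | mem x hx =>
    obtain ⟨P, hP, rfl⟩ := hx
    open ZeroObject in
    refine ⟨P, 0, hP, E.isProjective_of_isZero (isZero_zero C), ?_⟩
    rw [show IsoClasses.mk (0 : C) = 0 from rfl, map_zero, sub_zero]
  | zero =>
    open ZeroObject in
    exact ⟨0, 0, E.isProjective_of_isZero (isZero_zero C), E.isProjective_of_isZero (isZero_zero C),
      (sub_self _).symm⟩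
  | add x y _ _ hx hy =>
    obtain ⟨P, Q, hP, hQ, rfl⟩ := hx
    obtain ⟨P', Q', hP', hQ', rfl⟩ := hy
    refine ⟨P ⊞ P', Q ⊞ Q', E.isProjective_biprod hP hP', E.isProjective_biprod hQ hQ', ?_⟩
    rw [IsoClasses.mk_biprod, IsoClasses.mk_biprod, map_add, map_add]
    abel
  | neg x _ hx =>
    obtain ⟨P, Q, hP, hQ, rfl⟩ := hx
    exact ⟨Q, P, hQ, hP, neg_sub _ _⟩

variable [HasFiniteBiproducts C] {E}

/-- Two objects of a Krull-Schmidt category have the same class in `K_E(C)` only if they are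
isomorphic up to projective summands. -/
theorem exists_iso_of_cls_eq (hC : IsKrullSchmidt C) {X Y : C} (h : E.cls X = E.cls Y) :
    ∃ P Q, E.IsProjective P ∧ E.IsProjective Q ∧ Nonempty (X ⊞ P ≅ Y ⊞ Q) := by
  have h := congrArg E.kGroupToGrothendieck h
  rw [kGroupToGrothendieck_cls, kGroupToGrothendieck_cls, ← sub_eq_zero,
    ← QuotientAddGroup.mk_sub, QuotientAddGroup.eq_zero_iff] at h
  obtain ⟨Q, P, hQ, hP, h⟩ := E.exists_of_mem_projSubgroup h
  refine ⟨P, Q, hP, hQ, ?_⟩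
  rw [sub_eq_sub_iff_add_eq_add, ← map_add, ← map_add] at h
  obtain ⟨⟨⟨Z⟩, _⟩, hZ⟩ := (AddLocalization.addMonoidOf _).eq_iff_exists.1 h
  have hZ : IsoClasses.mk (Z ⊞ (X ⊞ P)) = IsoClasses.mk (Z ⊞ (Q ⊞ Y)) := hZ
  obtain ⟨e⟩ := IsoClasses.mk_eq_mk.1 hZ
  obtain ⟨e⟩ := hC.cancel Z e
  exact ⟨e ≪≫ biprod.braiding Q Y⟩

theorem isProjective_of_cls_eq_zero (hC : IsKrullSchmidt C) {X : C} (h : E.cls X = 0) :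
    E.IsProjective X := by
  open ZeroObject in
  have h0 := E.isProjective_of_isZero (isZero_zero C)
  obtain ⟨P, Q, -, hQ, ⟨e⟩⟩ := exists_iso_of_cls_eq hC (h.trans (E.cls_proj h0).symm)
  exact (E.isProjective_biprod h0 hQ).of_retract (biprod.inl ≫ e.hom) (e.inv ≫ biprod.fst)
    (by simp)

end KGroup

/-! ### Stable summands -/

section Stable

variable {C : Type u} [Category.{v} C] [Preadditive C] [HasZeroObject C] [HasBinaryBiproducts C]
  {E : ExactStructure C}

theorem toStable_map_eq_iff {X Y : C} (f g : X ⟶ Y) :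
    E.toStable.map f = E.toStable.map g ↔ E.Factors (f - g) :=
  CategoryTheory.Quotient.functor_map_eq_iff E.stableRel f g

theorem StableAdd.of_stable_summand {M : C} {X Y : E.StableCat}
    (e : E.toStable.obj M ≅ X ⊞ Y) : E.StableAdd M X.as := by
  obtain ⟨a, ha⟩ := E.toStable.map_surjective
    (show E.toStable.obj X.as ⟶ E.toStable.obj M from biprod.inl ≫ e.inv)
  obtain ⟨b, hb⟩ := E.toStable.map_surjective
    (show E.toStable.obj M ⟶ E.toStable.obj X.as from e.hom ≫ biprod.fst)
  refine .of_factors_sub a b ((toStable_map_eq_iff _ _).1 ?_)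
  rw [Functor.map_comp, ha, hb, CategoryTheory.Functor.map_id]
  change (biprod.inl ≫ e.inv) ≫ e.hom ≫ biprod.fst = 𝟙 X
  simp

theorem isProjective_of_isZero_toStable {X : C} (h : IsZero (E.toStable.obj X)) :
    E.IsProjective X := by
  refine isProjective_of_factors_id ?_
  rw [← sub_zero (𝟙 X), ← toStable_map_eq_iff]
  exact h.eq_of_src _ _

theorem isZero_of_isIso_fst_inl {D : Type*} [Category D] [Preadditive D] {Y Z : D}
    [HasBinaryBiproduct Y Z] (h : IsIso (biprod.fst ≫ biprod.inl : Y ⊞ Z ⟶ Y ⊞ Z)) :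
    IsZero Z := by
  have : (biprod.inr : Z ⟶ Y ⊞ Z) = 0 := by
    rw [← cancel_mono (biprod.fst ≫ biprod.inl : Y ⊞ Z ⟶ Y ⊞ Z)]
    simp
  rw [IsZero.iff_id_eq_zero, ← biprod.inr_snd (X := Y), this, zero_comp]

theorem isZero_of_isIso_snd_inr {D : Type*} [Category D] [Preadditive D] {Y Z : D}
    [HasBinaryBiproduct Y Z] (h : IsIso (biprod.snd ≫ biprod.inr : Y ⊞ Z ⟶ Y ⊞ Z)) :
    IsZero Y := by
  have : (biprod.inl : Y ⟶ Y ⊞ Z) = 0 := by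
    rw [← cancel_mono (biprod.snd ≫ biprod.inr : Y ⊞ Z ⟶ Y ⊞ Z)]
    simp
  rw [IsZero.iff_id_eq_zero, ← biprod.inl_fst (Y := Z), this, zero_comp]

theorem indecomposable_toStable {X : C} (hX : IsLocalRing (End X))
    (h : ¬ IsZero (E.toStable.obj X)) : Indecomposable (E.toStable.obj X) := by
  refine ⟨h, fun Y Z φ => ?_⟩
  obtain ⟨f, hf⟩ := E.toStable.map_surjective (φ.hom ≫ (biprod.fst ≫ biprod.inl) ≫ φ.inv)
  have hsum : (show End X from f) + (show End X from 𝟙 X - f) = 1 := add_sub_cancel f (𝟙 X)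
  rcases IsLocalRing.isUnit_or_isUnit_of_add_one hsum with hu | hu
  · right
    have : IsIso f := (isUnit_iff_isIso _).1 hu
    have h1 : IsIso (E.toStable.map f) := inferInstance
    rw [hf] at h1
    have h2 := IsIso.of_isIso_comp_left φ.hom ((biprod.fst ≫ biprod.inl) ≫ φ.inv)
    exact isZero_of_isIso_fst_inl (IsIso.of_isIso_comp_right _ φ.inv)
  · left
    have : IsIso (𝟙 X - f) := (isUnit_iff_isIso _).1 hu
    have h1 : IsIso (E.toStable.map (𝟙 X - f)) := inferInstance
    have h3 : E.toStable.map (𝟙 X - f) = φ.hom ≫ (biprod.snd ≫ biprod.inr) ≫ φ.inv := by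
      rw [Functor.map_sub, hf, CategoryTheory.Functor.map_id, sub_eq_iff_eq_add,
        ← Preadditive.comp_add, ← Preadditive.add_comp, add_comm, biprod.total]
      simp
    rw [h3] at h1
    have h2 := IsIso.of_isIso_comp_left φ.hom ((biprod.snd ≫ biprod.inr) ≫ φ.inv)
    exact isZero_of_isIso_snd_inr (IsIso.of_isIso_comp_right _ φ.inv)

theorem toStable_biprod (X Y : C) :
    Nonempty (E.toStable.obj (X ⊞ Y) ≅ E.toStable.obj X ⊞ E.toStable.obj Y) := by
  have := preservesBinaryBiproducts_of_preservesBiproducts E.toStable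
  exact ⟨E.toStable.mapBiprod X Y⟩

end Stable

/-! ### The subgroup `⟨M⟩` -/

section Span

variable {C : Type u} [Category.{v} C] [Preadditive C] [HasZeroObject C] [HasBinaryBiproducts C]
  {E : ExactStructure C}

theorem span_le_of_toStable_iso {M N : C} (e : E.toStable.obj M ≅ E.toStable.obj N) :
    E.span N ≤ E.span M :=
  AddSubgroup.closure_mono fun _ ⟨X, Y, hX, ⟨e'⟩, hx⟩ => ⟨X, Y, hX, ⟨e ≪≫ e'⟩, hx⟩

theorem span_le_span_biprod (M N : C) : E.span N ≤ E.span (M ⊞ N) := by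
  obtain ⟨e⟩ := toStable_biprod (E := E) M N
  refine AddSubgroup.closure_mono fun _ ⟨X, Y, hX, ⟨e'⟩, hx⟩ =>
    ⟨X, Y ⊞ E.toStable.obj M, hX, ⟨?_⟩, hx⟩
  exact e ≪≫ biprod.braiding _ _ ≪≫ biprod.mapIso e' (Iso.refl _) ≪≫ biprod.associator _ _ _

/-- Over a Krull-Schmidt category, the class of `M` lies in `⟨M⟩`. -/
theorem cls_mem_span [HasFiniteBiproducts C] (hC : IsKrullSchmidt C) (M : C) :
    E.cls M ∈ E.span M := by
  refine hC.induction (p := fun M => E.cls M ∈ E.span M) ?_ ?_ ?_ M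
  · intro X Y e h
    rw [← E.cls_iso e]
    exact span_le_of_toStable_iso (E.toStable.mapIso e.symm) h
  · intro X hX
    rw [E.cls_proj (E.isProjective_of_isZero hX)]
    exact zero_mem _
  · intro X Y hX hY
    rw [E.cls_sum (Iso.refl _)]
    refine add_mem ?_ (span_le_span_biprod X Y hY)
    by_cases h : IsZero (E.toStable.obj X)
    · rw [E.cls_proj (isProjective_of_isZero_toStable h)]
      exact zero_mem _
    · exact AddSubgroup.subset_closure
        ⟨E.toStable.obj X, E.toStable.obj Y, indecomposable_toStable hX h, toStable_biprod X Y, rfl⟩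

theorem exists_of_mem_span {M : C} {x : E.KGroup} (hx : x ∈ E.span M) :
    ∃ A B, E.StableAdd M A ∧ E.StableAdd M B ∧ x = E.cls A - E.cls B := by
  open ZeroObject in
  have h0 : E.StableAdd M 0 := .of_isZero (isZero_zero C)
  have hc : E.cls (0 : C) = 0 := E.cls_proj (E.isProjective_of_isZero (isZero_zero C))
  induction hx using AddSubgroup.closure_induction with
  | mem x hx =>
    obtain ⟨X, Y, -, ⟨e⟩, rfl⟩ := hx
    exact ⟨X.as, 0, .of_stable_summand e, h0, by rw [hc, sub_zero]⟩
  | zero => exact ⟨0, 0, h0, h0, (sub_self _).symm⟩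
  | add x y _ _ hx hy =>
    obtain ⟨A, B, hA, hB, rfl⟩ := hx
    obtain ⟨A', B', hA', hB', rfl⟩ := hy
    refine ⟨A ⊞ A', B ⊞ B', hA.biprod hA', hB.biprod hB', ?_⟩
    rw [E.cls_sum (Iso.refl _), E.cls_sum (Iso.refl (B ⊞ B'))]
    abel
  | neg x _ hx =>
    obtain ⟨A, B, hA, hB, rfl⟩ := hx
    exact ⟨B, A, hB, hA, (neg_sub _ _)⟩

variable [E.EnoughProjectives]

variable (E) in
/-- The iterates of `Ω_E`, as additive maps. -/
def omegaPow (m : ℕ) : E.KGroup →+ E.KGroup := HPow.hPow (α := AddMonoid.End E.KGroup) E.omega m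

theorem omegaPow_succ (m : ℕ) : E.omegaPow (m + 1) = E.omega.comp (E.omegaPow m) :=
  pow_succ' (M := AddMonoid.End E.KGroup) _ _

theorem omegaPow_cls (m : ℕ) (M : C) : E.omegaPow m (E.cls M) = E.cls (E.syzygy^[m] M) := by
  induction m with
  | zero => rfl
  | succ m ih =>
    rw [omegaPow_succ, AddMonoidHom.comp_apply, ih, Function.iterate_succ_apply', E.omega_cls]

theorem omegaSpan_eq_map (M : C) (m : ℕ) : E.omegaSpan M m = (E.span M).map (E.omegaPow m) := rfl

theorem omegaSpan_succ (M : C) (m : ℕ) :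
    E.omegaSpan M (m + 1) = (E.omegaSpan M m).map E.omega := by
  rw [omegaSpan_eq_map, omegaSpan_eq_map, AddSubgroup.map_map, omegaPow_succ]

theorem bijOn_omega_iff (M : C) (m : ℕ) :
    Set.BijOn E.omega (E.omegaSpan M m) (E.omegaSpan M (m + 1)) ↔
      ∀ x ∈ E.omegaSpan M m, E.omega x = 0 → x = 0 := by
  constructor
  · intro h x hx h0
    exact h.injOn hx (zero_mem (E.omegaSpan M m)) (h0.trans (map_zero _).symm)
  · intro h
    rw [omegaSpan_succ]
    refine Set.InjOn.bijOn_image fun x hx y hy hxy => ?_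
    exact sub_eq_zero.1 (h _ (sub_mem hx hy) (by rw [map_sub, hxy, sub_self]))

theorem exists_of_mem_omegaSpan {M : C} {m : ℕ} {x : E.KGroup} (hx : x ∈ E.omegaSpan M m) :
    ∃ A B, E.StableAdd M A ∧ E.StableAdd M B ∧
      x = E.cls (E.syzygy^[m] A) - E.cls (E.syzygy^[m] B) := by
  rw [omegaSpan_eq_map] at hx
  obtain ⟨y, hy, rfl⟩ := hx
  obtain ⟨A, B, hA, hB, rfl⟩ := exists_of_mem_span hy
  exact ⟨A, B, hA, hB, by rw [map_sub, omegaPow_cls, omegaPow_cls]⟩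

end Span

/-! ### Objects without extensions by projectives -/

section Gorenstein

variable {C : Type u} [Category.{v} C] [Preadditive C] [HasBinaryBiproducts C]

/-- The dual of Schanuel's lemma: if two morphisms `W ⟶ R` and `W ⟶ R'` (with sources identified
by `e`) extend along each other, then their cokernels agree up to the summands `R` and `R'`. -/
theorem dual_schanuel {W W' R R' A A' : C} {i : W ⟶ R} {p : R ⟶ A} {i' : W' ⟶ R'} {p' : R' ⟶ A'}
    {w : i ≫ p = 0} {w' : i' ≫ p' = 0} (hp : IsColimit (CokernelCofork.ofπ p w))
    (hp' : IsColimit (CokernelCofork.ofπ p' w')) (e : W ≅ W') {s : R ⟶ R'} {t : R' ⟶ R}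
    (hs : i ≫ s = e.hom ≫ i') (ht : i' ≫ t = e.inv ≫ i) : Nonempty (R' ⊞ A ≅ R ⊞ A') := by
  have hst : i ≫ s ≫ t = i := by
    rw [← Category.assoc, hs, Category.assoc, ht, Iso.hom_inv_id_assoc]
  have hts : i' ≫ t ≫ s = i' := by
    rw [← Category.assoc, ht, Category.assoc, hs, Iso.inv_hom_id_assoc]
  have hsp : i ≫ s ≫ p' = 0 := by rw [← Category.assoc, hs, Category.assoc, w', comp_zero]
  have htp : i' ≫ t ≫ p = 0 := by rw [← Category.assoc, ht, Category.assoc, w, comp_zero]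
  -- both biproducts are pushouts of `i` and `i'`; `f` and `g` are the components out of the
  -- cokernels of the two mutually inverse comparison maps
  obtain ⟨f, hf⟩ := CokernelCofork.IsColimit.desc' hp
    (biprod.lift (𝟙 R - s ≫ t) (-(s ≫ p'))) (by ext <;> simp [hst, hsp])
  obtain ⟨g, hg⟩ := CokernelCofork.IsColimit.desc' hp'
    (biprod.lift (𝟙 R' - t ≫ s) (-(t ≫ p))) (by ext <;> simp [hts, htp])
  have hf : p ≫ f = _ := hf
  have hg : p' ≫ g = _ := hg
  have ep : Epi p := Cofork.IsColimit.epi hp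
  have ep' : Epi p' := Cofork.IsColimit.epi hp'
  refine ⟨⟨biprod.desc (biprod.lift t p') f, biprod.desc (biprod.lift s p) g, ?_, ?_⟩⟩
  · apply biprod.hom_ext'
    · rw [biprod.inl_desc_assoc, biprod.lift_desc, hg]
      ext <;> simp
    · rw [biprod.inr_desc_assoc, ← cancel_epi p, ← Category.assoc, hf, biprod.lift_desc,
        Preadditive.neg_comp, Category.assoc s, hg]
      ext <;> simp
  · apply biprod.hom_ext'
    · rw [biprod.inl_desc_assoc, biprod.lift_desc, hf]
      ext <;> simp
    · rw [biprod.inr_desc_assoc, ← cancel_epi p', ← Category.assoc, hg, biprod.lift_desc,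
        Preadditive.neg_comp, Category.assoc t, hf]
      ext <;> simp

/-- Adding an identity to a morphism does not change its cokernel. -/
def isColimitBiprodMapId {K P X : C} {i : K ⟶ P} {p : P ⟶ X} {w : i ≫ p = 0}
    (hp : IsColimit (CokernelCofork.ofπ p w)) (Q : C) :
    IsColimit (CokernelCofork.ofπ (f := biprod.map i (𝟙 Q)) (biprod.desc p 0)
      (by ext <;> simp [w])) :=
  have h {T : C} (g : P ⊞ Q ⟶ T) (hg : biprod.map i (𝟙 Q) ≫ g = 0) :
      i ≫ biprod.inl ≫ g = 0 ∧ biprod.inr ≫ g = 0 := by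
    have h1 := congrArg (fun x => biprod.inl ≫ x) hg
    have h2 := congrArg (fun x => biprod.inr ≫ x) hg
    constructor
    · simpa using h1
    · simpa using h2
  CokernelCofork.IsColimit.ofπ _ _
    (fun g hg => (CokernelCofork.IsColimit.desc' hp (biprod.inl ≫ g) (h g hg).1).1)
    (fun g hg => by
      ext
      · simpa using (CokernelCofork.IsColimit.desc' hp (biprod.inl ≫ g) (h g hg).1).2
      · simpa using (h g hg).2.symm)
    (fun g hg m hm => by
      refine Cofork.IsColimit.hom_ext hp ?_
      refine Eq.trans ?_ (CokernelCofork.IsColimit.desc' hp (biprod.inl ≫ g) (h g hg).1).2.symm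
      simp [← hm])

variable [HasZeroObject C] [HasFiniteBiproducts C] {E : ExactStructure C}

/-- Objects without extensions by projectives are determined in `K_E(C)` by their syzygies. -/
theorem cls_eq_of_cls_K_eq (hC : IsKrullSchmidt C) {A B : C} (r : E.Presentation A)
    (r' : E.Presentation B) (hA : ∀ P, E.IsProjective P → r.Extends P)
    (hB : ∀ P, E.IsProjective P → r'.Extends P) (h : E.cls r.K = E.cls r'.K) :
    E.cls A = E.cls B := by
  obtain ⟨P, Q, hP, hQ, ⟨e⟩⟩ := exists_iso_of_cls_eq hC h
  have key {A B : C} (r : E.Presentation A) (r' : E.Presentation B) {P Q : C}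
      (hQ : E.IsProjective Q) (hA : ∀ P, E.IsProjective P → r.Extends P)
      (e : r.K ⊞ P ⟶ r'.K ⊞ Q) :
      ∃ s, biprod.map r.i (𝟙 P) ≫ s = e ≫ biprod.map r'.i (𝟙 Q) := by
    obtain ⟨s, hs⟩ := hA _ (E.isProjective_biprod r'.projective hQ)
      (biprod.inl ≫ e ≫ biprod.map r'.i (𝟙 Q))
    refine ⟨biprod.desc s (biprod.inr ≫ e ≫ biprod.map r'.i (𝟙 Q)), ?_⟩
    apply biprod.hom_ext' <;> simp [hs]
  obtain ⟨s, hs⟩ := key r r' hQ hA e.hom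
  obtain ⟨t, ht⟩ := key r' r hP hB e.inv
  obtain ⟨f⟩ := dual_schanuel (isColimitBiprodMapId (E.cokernel _ r.exact).some P)
    (isColimitBiprodMapId (E.cokernel _ r'.exact).some Q) e hs ht
  have h := (E.cls_sum (Iso.refl _)).symm.trans ((E.cls_iso f).trans (E.cls_sum (Iso.refl _)))
  rwa [E.cls_proj (E.isProjective_biprod r'.projective hQ),
    E.cls_proj (E.isProjective_biprod r.projective hP), zero_add, zero_add] at h

variable [E.EnoughProjectives]

theorem phi_le_of_extends (hC : IsKrullSchmidt C) {M : C} {n : ℕ}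
    (h : ∀ j ≥ n, ∀ P, E.IsProjective P → (E.presentation (E.syzygy^[j] M)).Extends P) :
    E.Phi M ≤ n := by
  refine Nat.sInf_le fun m hm => (bijOn_omega_iff M m).2 fun x hx hx0 => ?_
  obtain ⟨A, B, hA, hB, rfl⟩ := exists_of_mem_omegaSpan hx
  rw [map_sub, sub_eq_zero, E.omega_cls, E.omega_cls] at hx0
  exact sub_eq_zero.2 (cls_eq_of_cls_K_eq hC _ _
    (fun P hP => hA.extends_iterate (h m hm P hP)) (fun P hP => hB.extends_iterate (h m hm P hP))
    hx0)

/-- If `M` has no extensions by projectives above degree `n`, then `Ψ_E(M) ≤ n`. -/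
theorem psi_le_of_extends (hC : IsKrullSchmidt C) {M : C} {n : ℕ}
    (h : ∀ j ≥ n, ∀ P, E.IsProjective P → (E.presentation (E.syzygy^[j] M)).Extends P) :
    E.Psi M ≤ n := by
  have hk := phi_le_of_extends hC h
  have hfpd : E.fpd (addClass (E.syzygy^[E.Phi M] M)) ≤ (n - E.Phi M : ℕ) := by
    refine iSup₂_le fun X hX => iSup_le fun hfin => E.pd_le_of_extends hfin _ fun j hj P hP => ?_
    refine hX.stableAdd.extends_iterate ?_
    rw [← Function.iterate_add_apply]
    exact h _ (by omega) P hP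
  calc E.Psi M ≤ (E.Phi M : ℕ∞) + (n - E.Phi M : ℕ) := add_le_add_right hfpd _
    _ = n := by rw [← Nat.cast_add, Nat.add_sub_cancel' hk]

/-- If `pd_E(M)` is finite then `pd_E(M) ≤ Φ_E(M)`: the classes of the syzygies of `M` vanish
eventually, so they vanish from degree `Φ_E(M)` on, where `Ω_E` is injective. -/
theorem pd_le_phi (hC : IsKrullSchmidt C) {M : C} (hM : E.pd M < ⊤) : E.pd M ≤ E.Phi M := by
  obtain ⟨d, hd⟩ := ENat.ne_top_iff_exists.1 hM.ne
  have hproj {m : ℕ} (hm : d ≤ m) {A : C} (hA : E.StableAdd M A) :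
      E.IsProjective (E.syzygy^[m] A) :=
    (E.presentation _).isProjective_of_extends (hA.extends_iterate
      ((E.pd_le_iff_forall M d).1 hd.ge m hm _))
  -- the set defining `Φ_E(M)` contains `d`, so its infimum is not a junk value
  have hne : {k : ℕ | ∀ m ≥ k, Set.BijOn E.omega (E.omegaSpan M m)
      (E.omegaSpan M (m + 1))}.Nonempty := by
    refine ⟨d, fun m hm => (bijOn_omega_iff M m).2 fun x hx _ => ?_⟩
    obtain ⟨A, B, hA, hB, rfl⟩ := exists_of_mem_omegaSpan hx
    rw [E.cls_proj (hproj hm hA), E.cls_proj (hproj hm hB), sub_zero]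
  have key {m : ℕ} (hm : E.Phi M ≤ m) :
      E.cls (E.syzygy^[m] M) = 0 → E.cls (E.syzygy^[E.Phi M] M) = 0 := by
    induction m, hm using Nat.le_induction with
    | base => exact id
    | succ m hm ih =>
      intro h0
      rw [Function.iterate_succ_apply', ← E.omega_cls] at h0
      refine ih ((bijOn_omega_iff M m).1 (Nat.sInf_mem hne m hm) _ ?_ h0)
      exact ⟨E.cls M, cls_mem_span hC M, omegaPow_cls _ _⟩
  rw [pd_le_iff]
  exact isProjective_of_cls_eq_zero hC (key (le_max_left _ d)
    (E.cls_proj (hproj (le_max_right _ d) (.refl E M))))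

/-- If `id_E(P(E)) ≤ n` then no object has extensions by projectives above degree `n`. -/
theorem extends_of_injdClass_le {n : ℕ} (h : E.injdClass E.IsProjective ≤ n) (M : C) :
    ∀ j ≥ n, ∀ P, E.IsProjective P → (E.presentation (E.syzygy^[j] M)).Extends P :=
  fun j hj P hP => (E.injd_le_iff P n).1 ((le_iSup₂ (f := fun X _ => E.injd X) P hP).trans h) j hj M

theorem fpd_le_phiDim (hC : IsKrullSchmidt C) (Y : C → Prop) : E.fpd Y ≤ E.PhiDim Y :=
  iSup₂_mono fun _ _ => iSup_le fun hfin => pd_le_phi hC hfin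

variable (E) in
theorem phiDim_le_psiDim (Y : C → Prop) : E.PhiDim Y ≤ E.PsiDim Y :=
  iSup₂_mono fun _ _ => le_self_add

theorem psiDim_le_injdClass (hC : IsKrullSchmidt C) (Y : C → Prop) :
    E.PsiDim Y ≤ E.injdClass E.IsProjective := by
  induction hn : E.injdClass E.IsProjective using ENat.recTopCoe with
  | top => exact le_top
  | coe n => exact iSup₂_le fun M _ => psi_le_of_extends hC (extends_of_injdClass_le hn.le M)

theorem psiDim_syzygyClass (hC : IsKrullSchmidt C) {n : ℕ} (h : E.injdClass E.IsProjective ≤ n) :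
    E.PsiDim (E.syzygyClass n) = 0 := by
  refine le_antisymm (iSup₂_le ?_) zero_le
  rintro K ⟨M, hM⟩
  refine psi_le_of_extends (n := 0) hC fun j _ P hP => hM.stableAdd.extends_iterate ?_
  rw [← Function.iterate_add_apply]
  exact extends_of_injdClass_le h M _ (by omega) P hP

end Gorenstein

/-! ### Homological dimensions for the maximal exact structure -/

section Abelian

variable {C : Type u} [Category.{v} C] [Abelian C]

theorem maxExact_isProjective_iff (P : C) : (maxExact C).IsProjective P ↔ Projective P := by
  constructor
  · refine fun h => ⟨fun {A B} f e he => ?_⟩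
    obtain ⟨K, i, w, hE⟩ := (exists_kernel_iff_epi e).2 he
    exact h _ hE f
  · intro h S hS f
    have : S.ShortExact := hS
    have := this.epi_g
    exact ⟨Projective.factorThru f S.g, Projective.factorThru_comp f S.g⟩

variable [CategoryTheory.EnoughProjectives C]

theorem pd_maxExact_le_iff (X : C) (n : ℕ) :
    (maxExact C).pd X ≤ n ↔ HasProjectiveDimensionLE X n := by
  rw [pd_le_iff, maxExact_isProjective_iff]
  induction n generalizing X with
  | zero => exact projective_iff_hasProjectiveDimensionLE_zero (X := X)
  | succ n ih =>
    let r := (maxExact C).presentation X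
    rw [Function.iterate_succ_apply, ih]
    exact (ShortComplex.ShortExact.hasProjectiveDimensionLT_X₃_iff
      (show (ShortComplex.mk r.i r.p r.zero).ShortExact from r.exact) n
      ((maxExact_isProjective_iff _).1 r.projective)).symm

open Abelian in
/-- Dimension shifting: if the Yoneda group `Ext^(j+1)(X, B)` vanishes then morphisms from the
`(j+1)`-st syzygy of `X` to `B` extend. -/
theorem extends_of_ext_eq_zero [HasExt.{w} C] {X B : C} {j : ℕ}
    (h : ∀ e : Abelian.Ext X B (j + 1), e = 0) :
    ((maxExact C).presentation ((maxExact C).syzygy^[j] X)).Extends B := by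
  induction j generalizing X with
  | zero =>
    let r := (maxExact C).presentation X
    have hS : (ShortComplex.mk r.i r.p r.zero).ShortExact := r.exact
    intro g
    obtain ⟨x, hx⟩ := Ext.contravariant_sequence_exact₁ hS B (Ext.mk₀ g) (n₁ := 1) rfl (h _)
    obtain ⟨f, rfl⟩ := Ext.addEquiv₀.symm.surjective x
    refine ⟨f, Ext.addEquiv₀.symm.injective ?_⟩
    exact (Ext.mk₀_comp_mk₀ _ _).symm.trans hx
  | succ j ih =>
    let r := (maxExact C).presentation X
    have hS : (ShortComplex.mk r.i r.p r.zero).ShortExact := r.exact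
    have : Projective r.P := (maxExact_isProjective_iff _).1 r.projective
    rw [Function.iterate_succ_apply]
    refine ih fun e => ?_
    obtain ⟨x, rfl⟩ := Ext.contravariant_sequence_exact₁ hS B e (add_comm 1 (j + 1)) (h _)
    rw [show x = 0 from x.eq_zero_of_projective]
    exact map_zero ((Ext.mk₀ r.i).precomp B (zero_add (j + 1)))

theorem injd_maxExact_le {B : C} {n : ℕ} (h : HasInjectiveDimensionLE B n) :
    (maxExact C).injd B ≤ n := by
  let := HasExt.standard C
  rw [injd_le_iff]
  exact fun j hj X => extends_of_ext_eq_zero fun e : Abelian.Ext X B (j + 1) =>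
    e.eq_zero_of_hasInjectiveDimensionLT (n + 1) (by omega)

end Abelian

end ExactStructure

/-! ### Finitely generated modules over an artinian ring -/

section LocalDecomposition

variable {C : Type u} [Category.{v} C] [Preadditive C] [HasBinaryBiproducts C]
  [HasFiniteBiproducts C]

/-- `X` is a finite direct sum of objects with local endomorphism ring. -/
def HasLocalDecomposition (X : C) : Prop :=
  ∃ (n : ℕ) (f : Fin n → C), (∀ i, IsLocalRing (End (f i))) ∧ Nonempty (X ≅ ⨁ f)

theorem HasLocalDecomposition.of_iso {X Y : C} (h : HasLocalDecomposition Y) (e : X ≅ Y) :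
    HasLocalDecomposition X := by
  obtain ⟨n, f, hf, ⟨e'⟩⟩ := h
  exact ⟨n, f, hf, ⟨e ≪≫ e'⟩⟩

theorem HasLocalDecomposition.of_isZero {X : C} (h : IsZero X) : HasLocalDecomposition X :=
  ⟨0, Fin.elim0, fun i => i.elim0, ⟨h.iso (isZero_biproduct_fin_zero _)⟩⟩

theorem HasLocalDecomposition.biprod_of_isLocalRing {X Y : C} (hX : IsLocalRing (End X))
    (hY : HasLocalDecomposition Y) : HasLocalDecomposition (X ⊞ Y) := by
  obtain ⟨n, f, hf, ⟨e⟩⟩ := hY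
  exact ⟨n + 1, Fin.cons X f, Fin.cases hX hf,
    ⟨biprod.mapIso (Iso.refl X) e ≪≫ (biproductFinSuccIso (Fin.cons X f : Fin (n + 1) → C)).symm⟩⟩

theorem HasLocalDecomposition.of_isLocalRing [HasZeroObject C] {X : C}
    (hX : IsLocalRing (End X)) : HasLocalDecomposition X := by
  open ZeroObject in
  exact (biprod_of_isLocalRing hX (of_isZero (isZero_zero C))).of_iso
    (isoBiprodZero (isZero_zero C))

theorem HasLocalDecomposition.biprod {X Y : C} (hX : HasLocalDecomposition X)
    (hY : HasLocalDecomposition Y) : HasLocalDecomposition (X ⊞ Y) := by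
  obtain ⟨n, f, hf, ⟨e⟩⟩ := hX
  induction n generalizing X with
  | zero =>
    exact hY.of_iso (isoZeroBiprod (IsZero.of_iso (isZero_biproduct_fin_zero f) e)).symm
  | succ n ih =>
    exact (biprod_of_isLocalRing (hf 0) (ih _ (fun i => hf i.succ) (Iso.refl _))).of_iso
      (biprod.mapIso (e ≪≫ biproductFinSuccIso f) (Iso.refl Y) ≪≫ biprod.associator _ _ _)

end LocalDecomposition

section Modules

variable {Λ : Type u} [Ring Λ]

theorem isIso_of_bijective {M N : FGModuleCat.{u} Λ} (φ : M ⟶ N)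
    (h : Function.Bijective φ.hom.hom) : IsIso φ := by
  let e := LinearEquiv.ofBijective φ.hom.hom h
  exact ⟨FGModuleCat.ofHom e.symm.toLinearMap,
    FGModuleCat.hom_ext (LinearMap.ext e.symm_apply_apply),
    FGModuleCat.hom_ext (LinearMap.ext e.apply_symm_apply)⟩

/-- A direct sum decomposition of modules is one in the category of finitely generated modules. -/
def isoBiprodOfLinearEquiv [HasBinaryBiproducts (FGModuleCat.{u} Λ)] {M : FGModuleCat.{u} Λ}
    {A B : Type u} [AddCommGroup A] [Module Λ A] [Module.Finite Λ A] [AddCommGroup B] [Module Λ B]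
    [Module.Finite Λ B] (L : (A × B) ≃ₗ[Λ] M) : M ≅ FGModuleCat.of Λ A ⊞ FGModuleCat.of Λ B where
  hom := biprod.lift
    (FGModuleCat.ofHom (LinearMap.fst Λ A B ∘ₗ L.symm.toLinearMap) : M ⟶ FGModuleCat.of Λ A)
    (FGModuleCat.ofHom (LinearMap.snd Λ A B ∘ₗ L.symm.toLinearMap) : M ⟶ FGModuleCat.of Λ B)
  inv := biprod.desc
    (FGModuleCat.ofHom (L.toLinearMap ∘ₗ LinearMap.inl Λ A B) : FGModuleCat.of Λ A ⟶ M)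
    (FGModuleCat.ofHom (L.toLinearMap ∘ₗ LinearMap.inr Λ A B) : FGModuleCat.of Λ B ⟶ M)
  hom_inv_id := by
    rw [biprod.lift_desc]
    refine FGModuleCat.hom_ext (LinearMap.ext fun x => ?_)
    change L ((L.symm x).1, 0) + L (0, (L.symm x).2) = x
    rw [← map_add]
    simp
  inv_hom_id := by
    apply biprod.hom_ext' <;> apply biprod.hom_ext <;> simp only [Category.assoc,
      biprod.inl_desc_assoc, biprod.inr_desc_assoc, biprod.lift_fst, biprod.lift_snd,
      Category.comp_id, biprod.inl_fst, biprod.inl_snd, biprod.inr_fst, biprod.inr_snd] <;>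
      refine FGModuleCat.hom_ext (LinearMap.ext fun x => ?_)
    · change (L.symm (L (x, 0))).1 = x
      simp
    · change (L.symm (L (x, 0))).2 = 0
      simp
    · change (L.symm (L (0, x))).1 = 0
      simp
    · change (L.symm (L (0, x))).2 = x
      simp

variable [IsArtinianRing Λ]

/-- Fitting's lemma: a finitely generated module over an artinian ring is zero, or has local
endomorphism ring, or is the direct sum of two proper submodules. -/
theorem isLocalRing_end_or_exists_isCompl (M : FGModuleCat.{u} Λ) [Nontrivial M] :
    IsLocalRing (End M) ∨ ∃ p q : Submodule Λ M, IsCompl p q ∧ p ≠ ⊤ ∧ q ≠ ⊤ := by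
  by_cases h : ∀ φ : End M, IsUnit φ ∨ IsUnit (1 - φ)
  · left
    have : Nontrivial (End M) := by
      obtain ⟨x, hx⟩ := exists_ne (0 : M)
      refine ⟨1, 0, fun h => hx ?_⟩
      have h : (𝟙 M : M ⟶ M) = 0 := h
      exact congrArg (fun φ : M ⟶ M => φ.hom.hom x) h
    refine ⟨fun {a b} hab => ?_⟩
    rw [eq_sub_of_add_eq' hab]
    exact h a
  · right
    push Not at h
    obtain ⟨φ, h1, h2⟩ := h
    let f : Module.End Λ M := φ.hom.hom
    have hf : ¬ Function.Bijective f := fun hb =>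
      h1 ((isUnit_iff_isIso _).2 (isIso_of_bijective φ hb))
    have hf' : ¬ Function.Bijective (1 - f : Module.End Λ M) := fun hb =>
      h2 ((isUnit_iff_isIso _).2 (isIso_of_bijective (𝟙 M - (show M ⟶ M from φ)) hb))
    -- the exponent has to be positive for injectivity of `f ^ n` to give injectivity of `f`
    obtain ⟨n, hn, hn0⟩ :=
      (f.eventually_isCompl_ker_pow_range_pow.and (Filter.eventually_ge_atTop 1)).exists
    refine ⟨_, _, hn, fun hk => ?_, fun hr => ?_⟩
    · have : f ^ n = 0 := LinearMap.ker_eq_top.1 hk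
      have hu : IsUnit (1 - f) := IsNilpotent.isUnit_one_sub ⟨n, this⟩
      exact hf' ((Module.End.isUnit_iff _).1 hu)
    · have hinj : Function.Injective (f ^ n) := by
        rw [← LinearMap.ker_eq_bot]
        have := hn.disjoint
        rwa [hr, disjoint_top] at this
      obtain ⟨m, rfl⟩ := Nat.exists_eq_add_of_le' hn0
      have : Function.Injective f := by
        refine Function.Injective.of_comp (f := f ^ m) ?_
        rwa [pow_succ] at hinj
      exact hf (IsArtinian.bijective_of_injective_endomorphism f this)

theorem isKrullSchmidt_fgModuleCat [HasBinaryBiproducts (FGModuleCat.{u} Λ)]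
    [HasFiniteBiproducts (FGModuleCat.{u} Λ)] : IsKrullSchmidt (FGModuleCat.{u} Λ) := by
  intro M
  change HasLocalDecomposition M
  induction hl : Module.length Λ M using WellFoundedLT.induction generalizing M with
  | ind l ih =>
    rcases subsingleton_or_nontrivial M with hM | hM
    · refine .of_isZero ((IsZero.iff_id_eq_zero _).2 ?_)
      exact FGModuleCat.hom_ext (LinearMap.ext fun x => Subsingleton.elim _ _)
    · rcases isLocalRing_end_or_exists_isCompl M with h | ⟨p, q, hpq, hp, hq⟩
      · exact .of_isLocalRing h
      · refine HasLocalDecomposition.of_iso (.biprod ?_ ?_)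
          (isoBiprodOfLinearEquiv (Submodule.prodEquivOfIsCompl p q hpq))
        · exact ih _ (hl ▸ Submodule.length_lt hp) _ rfl
        · exact ih _ (hl ▸ Submodule.length_lt hq) _ rfl

open ExactStructure

theorem modPd_eq_pd (M : FGModuleCat.{u} Λ) : modPd Λ M = (maxExact (FGModuleCat.{u} Λ)).pd M := by
  refine le_antisymm ?_ (le_iInf₂ fun n hn => (pd_maxExact_le_iff M n).2 hn)
  induction h : (maxExact (FGModuleCat.{u} Λ)).pd M using ENat.recTopCoe with
  | top => exact le_top
  | coe n => exact iInf₂_le n ((pd_maxExact_le_iff M n).1 h.le)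

/-- The injective dimension of the regular module bounds that of all projectives, since these are
retracts of finite powers of the regular module. -/
theorem injdClass_le_selfInjDim :
    (maxExact (FGModuleCat.{u} Λ)).injdClass (maxExact (FGModuleCat.{u} Λ)).IsProjective ≤
      selfInjDim Λ := by
  refine iSup₂_le fun P hP => le_iInf₂ fun n hn => ?_
  have hΛ := injd_maxExact_le hn
  rw [injd_le_iff] at hΛ ⊢
  intro j hj X
  obtain ⟨m, f, hf⟩ := Module.Finite.exists_fin' Λ P
  have hpow : ((maxExact (FGModuleCat.{u} Λ)).presentation
      ((maxExact (FGModuleCat.{u} Λ)).syzygy^[j] X)).Extends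
        (FGModuleCat.of Λ (Fin m → Λ)) := fun g => by
    choose h hh using fun k => hΛ j hj X (g ≫ FGModuleCat.ofHom (LinearMap.proj k))
    refine ⟨FGModuleCat.ofHom (LinearMap.pi fun k => (h k).hom.hom), ?_⟩
    refine FGModuleCat.hom_ext (LinearMap.ext fun x => funext fun k => ?_)
    exact congrArg (fun φ => φ.hom.hom x) (hh k)
  have hP' := (maxExact_isProjective_iff P).1 hP
  let p : FGModuleCat.of Λ (Fin m → Λ) ⟶ P := FGModuleCat.ofHom f
  have : Epi p := by
    have : Epi ((forget₂ (FGModuleCat.{u} Λ) (ModuleCat.{u} Λ)).map p) :=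
      (ModuleCat.epi_iff_surjective _).2 hf
    exact Functor.epi_of_epi_map (forget₂ (FGModuleCat.{u} Λ) (ModuleCat.{u} Λ)) this
  exact hpow.of_retract (Projective.factorThru (𝟙 P) p) p (Projective.factorThru_comp _ _)

theorem finDim_eq_fpd : finDim Λ = (maxExact (FGModuleCat.{u} Λ)).fpd fun _ => True := by
  simp only [finDim, fpd, modPd_eq_pd, iSup_true]

end Modules

end

theorem mainTheorem3 :
    (∀ (C : Type u) [Category.{v} C] [Preadditive C]
      [HasZeroObject C] [HasBinaryBiproducts C] [HasFiniteBiproducts C]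
      (E : ExactStructure C) [ExactStructure.IsITContext.{w} E],
      WeaklyIdempotentComplete C →
      (∀ n : ℕ, E.injdClass E.IsProjective = n →
        E.PhiDim (E.syzygyClass n) = 0 ∧ E.PsiDim (E.syzygyClass n) = 0) ∧
      E.fpd (fun _ => True) ≤ E.PhiDim (fun _ => True) ∧
      E.PhiDim (fun _ => True) ≤ E.PsiDim (fun _ => True) ∧
      E.PsiDim (fun _ => True) ≤ E.injdClass E.IsProjective) ∧
    (∀ (R : Type w) [CommRing R] [IsArtinianRing R]
      (Λ : Type u) [Ring Λ] [Algebra R Λ] [Module.Finite R Λ],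
      haveI : IsNoetherianRing Λ := isNoetherianRing_of_artinAlgebra R Λ
      finDim Λ ≤ algPhiDim Λ ∧ algPhiDim Λ ≤ algPsiDim Λ ∧ algPsiDim Λ ≤ selfInjDim Λ) := by
  refine ⟨fun C _ _ _ _ _ E hE _ => ?_, fun R _ _ Λ _ _ _ => ?_⟩
  · have hC : IsKrullSchmidt C := hE.krullSchmidt
    refine ⟨fun n hn => ?_, ExactStructure.fpd_le_phiDim hC _, E.phiDim_le_psiDim _,
      ExactStructure.psiDim_le_injdClass hC _⟩
    have h := ExactStructure.psiDim_syzygyClass hC hn.le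
    exact ⟨le_antisymm ((E.phiDim_le_psiDim _).trans h.le) zero_le, h⟩
  · have : IsArtinianRing Λ := isArtinian_of_tower R inferInstance
    have : HasFiniteBiproducts (FGModuleCat.{u} Λ) := Abelian.hasFiniteBiproducts
    have hC := isKrullSchmidt_fgModuleCat (Λ := Λ)
    exact ⟨finDim_eq_fpd.le.trans (ExactStructure.fpd_le_phiDim hC _),
      ExactStructure.phiDim_le_psiDim _ _,
      (ExactStructure.psiDim_le_injdClass hC _).trans injdClass_le_selfInjDim⟩
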